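/- Let $d\ge 2$ be an even integer and let $R=\bigoplus_{n\ge 0}R^n$ be a graded-commutative Noetherian ring which is generated over $R^0$ by $R^d$, that is, $R=R^0[R^d]$. Let $\mathsf T$ be an $R$-linear triangulated category with shift $\Sigma$: there is a homomorphism of graded rings $\phi$ from $R$ to the graded center of $\mathsf T$, whose degree $n$ part consists of the natural transformations $\eta:\mathrm{id}_{\mathsf T}\to\Sigma^n$ with $\eta\Sigma=(-1)^n\Sigma\eta$. For objects $X,Y$ of $\mathsf T$ the group $\operatorname{Hom}^*_{\mathsf T}(X,Y)=\bigoplus_{n\in\mathbb Z}\operatorname{Hom}_{\mathsf T}(X,\Sigma^nY)$ is then a graded $R$-module; let $\lambda^n(X,Y)$ be the length of $\operatorname{Hom}_{\mathsf T}(X,\Sigma^nY)$ over $R^0$. Write $\operatorname{Hom}^*_{\mathsf T}(X,Y)\in\mathsf{noeth}^{\mathsf{fl}}(R)$ if the $R$-module $\bigoplus_{n\ge n_0}\operatorname{Hom}_{\mathsf T}(X,\Sigma^nY)$ is Noetherian for some $n_0\in\mathbb Z$ and $\lambda^n(X,Y)<\infty$ for all $n\in\mathbb Z$. In that case there are unique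 polynomials $g_0,\dots,g_{d-1}\in\mathbb Q[t]$ with $g_i(n)=\lambda^{dn+i}(X,Y)$ for all $n\gg 0$, and one defines: * $\operatorname{cx}(X,Y)=1+\max_i\deg g_i$, where the zero polynomial has degree $-1$; * $h(X,Y)(n)=\sum_{i=0}^{d-1}(-1)^{n+i}\lambda^{n+i}(X,Y)$ for $n\in\mathbb Z$, and $\Delta f(n)=f(n+d)-f(n)$ for $f:\mathbb Z\to\mathbb Z$; * for an integer $s\ge\operatorname{cx}(X,Y)$, the $s$-multiplicity $e^s(X,Y)$: if $\operatorname{cx}(X,Y)\ge 1$, it is the constant value of $\Delta^{s-1}h(X,Y)(n)$ for $n\gg0$; if $s=\operatorname{cx}(X,Y)=0$ and $\lambda^n(X,Y)=0$ for $n\ll 0$, it is $e^0(X,Y)=\sum_{n\in\mathbb Z}(-1)^n\lambda^n(X,Y)$. For $z\in R^d$, a Koszul object $Y/\!\!/z$ is an object in a distinguished triangle $Y\xrightarrow{\phi_Y(z)}\Sigma^dY\to Y/\!\!/z\to\Sigma Y$ (it is unique up to isomorphism). The element $z$ is eventually injective on $\operatorname{Hom}^*_{\mathsf T}(X,Y)$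 if multiplication by $z$, $\operatorname{Hom}_{\mathsf T}(X,\Sigma^nY)\to\operatorname{Hom}_{\mathsf T}(X,\Sigma^{n+d}Y)$, is injective for all $n\gg0$. **Theorem.** Let $X,Y$ be objects of $\mathsf T$ with $\operatorname{Hom}^*_{\mathsf T}(X,Y)\in\mathsf{noeth}^{\mathsf{fl}}(R)$, and assume that $R^0$ contains an infinite field or is local with infinite residue field. Then there is an element $z\in R^d$ which is eventually injective on $\operatorname{Hom}^*_{\mathsf T}(X,Y)$ and has the following properties. One has $\operatorname{Hom}^*_{\mathsf T}(X,Y/\!\!/z)\in\mathsf{noeth}^{\mathsf{fl}}(R)$, the Hilbert polynomials and complexities of $(X,Y)$ and of $(X,Y/\!\!/z)$ are defined, the multiplicities below are defined, and: 1. if $\operatorname{cx}(X,Y)\ge1$, then $\operatorname{cx}(X,Y/\!\!/z)=\operatorname{cx}(X,Y)-1$; 2. if $s\ge\operatorname{cx}(X,Y)\ge 2$, then $e^{s-1}(X,Y/\!\!/z)=e^s(X,Y)$; 3. if $\operatorname{cx}(X,Y)=1$ and $\lambda^n(X,Y)=0$ for $n\ll0$, then $e^0(X,Y/\!\!/z)=e^1(X,Y)$.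 -/

import Mathlib

open CategoryTheory Category Limits Pretriangulated Filter
open scoped DirectSum Polynomial

universe v u w

/-! ### Graded-commutative rings -/

/-- A ring `R = ⨁ n ≥ 0, R^n` is graded-commutative if `r * s = (-1)^(|r| |s|) * (s * r)` for all
homogeneous elements `r` and `s`. -/
def GradedCommutative {R : Type w} [Ring R] (𝒜 : ℕ → AddSubgroup R) : Prop :=
  ∀ (m n : ℕ) (r s : R), r ∈ 𝒜 m → s ∈ 𝒜 n → r * s = (-1) ^ (m * n) * (s * r)

/-- The ring `A` contains an infinite field (as a unital subring). -/
def ContainsInfiniteField (A : Type w) [Ring A] : Prop :=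
  ∃ k : Subring A, IsField k ∧ Infinite k

/-- The ring `A` is local and its residue field, the quotient by the maximal ideal, is infinite. -/
def IsLocalWithInfiniteResidueField (A : Type w) [Ring A] : Prop :=
  IsLocalRing A ∧ ∀ 𝔪 : Ideal A, 𝔪.IsMaximal → Infinite (A ⧸ 𝔪)

/-! ### The graded center, and linear triangulated categories -/

section Center

variable (T : Type u) [Category.{v} T] [HasShift T ℤ] [Preadditive T]
  [∀ n : ℤ, (shiftFunctor T n).Additive]

/-- The degree `n` component of the graded center of `T`: the natural transformations
`η : id ⟶ Σ^n` such that `η Σ = (-1)^n Σ η`, where `Σ Σ^n` and `Σ^n Σ` are identified through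
the canonical isomorphism. -/
def gradedCenter (n : ℤ) : AddSubgroup (𝟭 T ⟶ shiftFunctor T n) where
  carrier := {η | ∀ X : T, η.app (X⟦(1 : ℤ)⟧) =
    n.negOnePow • ((shiftFunctor T (1 : ℤ)).map (η.app X) ≫ (shiftFunctorComm T n 1).hom.app X)}
  add_mem' := by
    intro a b ha hb X
    simp only [Set.mem_ofPred_eq] at ha hb
    rw [NatTrans.app_add, NatTrans.app_add, Functor.map_add, Preadditive.add_comp, smul_add,
      ha X, hb X]
  zero_mem' := by
    intro X
    simp only [NatTrans.app_zero]
    rw [Functor.map_zero, zero_comp, smul_zero]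
  neg_mem' := by
    intro a ha X
    simp only [Set.mem_ofPred_eq] at ha
    rw [NatTrans.app_neg, NatTrans.app_neg, Functor.map_neg, Preadditive.neg_comp, smul_neg, ha X]

variable {T}

/-- The element of `Hom(X, Σ^n X)` given by an element of degree `n` of the graded center. -/
def gradedCenterApp {n : ℤ} (η : gradedCenter T n) (X : T) : ShiftedHom X X n :=
  η.1.app X

variable (T)

/-- A central action on `T` of a graded ring `R = ⨁ n ≥ 0, R^n`: a homomorphism of graded rings
from `R` to the graded center of `T`. The product in the graded center is composition, that is,
`(η ζ)_X` is the composite of `ζ_X : X ⟶ Σ^n X` and `Σ^n (η_X) : Σ^n X ⟶ Σ^n Σ^m X`. -/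
structure CentralAction {R : Type w} [Ring R] (𝒜 : ℕ → AddSubgroup R) [GradedRing 𝒜] where
  /-- The components of the homomorphism. -/
  toCenter (n : ℕ) : 𝒜 n →+ gradedCenter T (n : ℤ)
  map_one (X : T) :
    gradedCenterApp (toCenter 0 (1 : 𝒜 0)) X = ShiftedHom.mk₀ ((0 : ℕ) : ℤ) Nat.cast_zero (𝟙 X)
  map_mul (m n : ℕ) (r : 𝒜 m) (s : 𝒜 n) (X : T) :
    gradedCenterApp (toCenter (m + n) ⟨(r : R) * s, SetLike.mul_mem_graded r.2 s.2⟩) X =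
      (gradedCenterApp (toCenter n s) X).comp (gradedCenterApp (toCenter m r) X)
        (Nat.cast_add m n).symm

end Center

namespace CentralAction

variable {T : Type u} [Category.{v} T] [HasShift T ℤ] [Preadditive T]
  [∀ n : ℤ, (shiftFunctor T n).Additive]
  {R : Type w} [Ring R] {𝒜 : ℕ → AddSubgroup R} [GradedRing 𝒜]

/-! ### The graded `R`-module `Hom^*(X, Y)` -/

/-- The morphism `φ_X(r) : X ⟶ Σ^m X` for `r` in `R^m`. -/
def app (φ : CentralAction T 𝒜) {m : ℕ} (r : 𝒜 m) (X : T) : ShiftedHom X X (m : ℤ) :=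
  gradedCenterApp (φ.toCenter m r) X

/-- The degree `n` component `Hom(X, Σ^n Y)` of `Hom^*(X, Y)`. -/
def HomDeg (_ : CentralAction T 𝒜) (X Y : T) (n : ℤ) : Type v := X ⟶ Y⟦n⟧

instance (φ : CentralAction T 𝒜) (X Y : T) (n : ℤ) : AddCommGroup (φ.HomDeg X Y n) :=
  inferInstanceAs (AddCommGroup (X ⟶ Y⟦n⟧))

/-- The action `Hom(X, Σ^n Y) ⟶ Hom(X, Σ^(m + n) Y)` of `r` in `R^m`, which is composition
with `Σ^n φ_Y(r)`. It is additive in both variables. -/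
noncomputable def act (φ : CentralAction T 𝒜) (X Y : T) (m : ℕ) (n k : ℤ) (h : (m : ℤ) + n = k) :
    𝒜 m →+ φ.HomDeg X Y n →+ φ.HomDeg X Y k where
  toFun r :=
    { toFun := fun f => ShiftedHom.comp (X := X) (Y := Y) (Z := Y) f (φ.app r Y) h
      map_zero' := ShiftedHom.zero_comp X n (φ.app r Y) h
      map_add' := fun f g => ShiftedHom.add_comp (X := X) (Y := Y) f g (φ.app r Y) h }
  map_zero' := by
    have h₀ : φ.app (0 : 𝒜 m) Y = 0 := by
      simp only [app, map_zero]
      rfl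
    refine AddMonoidHom.ext fun f => ?_
    exact (congrArg (fun t => ShiftedHom.comp (X := X) (Y := Y) f t h) h₀).trans
      (ShiftedHom.comp_zero (X := X) (Y := Y) Y f h)
  map_add' r s := by
    have h₀ : φ.app (r + s) Y = φ.app r Y + φ.app s Y := by
      simp only [app, map_add]
      rfl
    refine AddMonoidHom.ext fun f => ?_
    exact (congrArg (fun t => ShiftedHom.comp (X := X) (Y := Y) f t h) h₀).trans
      (ShiftedHom.comp_add (X := X) (Y := Y) f _ _ h)

theorem act_one (φ : CentralAction T 𝒜) (X Y : T) (n k : ℤ) (h : ((0 : ℕ) : ℤ) + n = k)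
    (f : X ⟶ Y⟦n⟧) : HEq (φ.act X Y 0 n k h 1 f) f := by
  obtain rfl : n = k := by simpa using h
  refine heq_of_eq ?_
  change ShiftedHom.comp (X := X) (Y := Y) f (gradedCenterApp (φ.toCenter 0 1) Y) h = f
  rw [φ.map_one, ShiftedHom.comp_mk₀_id]

theorem act_mul (φ : CentralAction T 𝒜) (X Y : T) (m m' : ℕ) (n k l : ℤ)
    (h : (m' : ℤ) + n = k) (h' : (m : ℤ) + k = l) (h'' : ((m + m' : ℕ) : ℤ) + n = l)
    (r : 𝒜 m) (s : 𝒜 m') (f : φ.HomDeg X Y n) :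
    φ.act X Y (m + m') n l h'' ⟨(r : R) * s, SetLike.mul_mem_graded r.2 s.2⟩ f =
      φ.act X Y m k l h' r (φ.act X Y m' n k h s f) := by
  change ShiftedHom.comp (X := X) (Y := Y) f
      (gradedCenterApp (φ.toCenter (m + m') ⟨(r : R) * s, SetLike.mul_mem_graded r.2 s.2⟩) Y) h'' =
    (ShiftedHom.comp (X := X) (Y := Y) f (gradedCenterApp (φ.toCenter m' s) Y) h).comp
      (gradedCenterApp (φ.toCenter m r) Y) h'
  rw [φ.map_mul]
  subst h
  exact (ShiftedHom.comp_assoc (X := X) (Y := Y) f (gradedCenterApp (φ.toCenter m' s) Y)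
    (gradedCenterApp (φ.toCenter m r) Y) rfl (Nat.cast_add m m').symm (by rw [← h', add_assoc])).symm

/-- `Hom(X, Σ^n Y)` is a module over `R^0`. -/
noncomputable instance (φ : CentralAction T 𝒜) (X Y : T) (n : ℤ) :
    Module (𝒜 0) (φ.HomDeg X Y n) where
  smul r f := φ.act X Y 0 n n (by simp) r f
  one_smul f := eq_of_heq (φ.act_one X Y n n (by simp) f)
  mul_smul r s f := by
    have := φ.act_mul X Y 0 0 n n n (by simp) (by simp) (by simp) r s f
    exact this
  smul_zero r := map_zero (φ.act X Y 0 n n (by simp) r)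
  smul_add r := map_add (φ.act X Y 0 n n (by simp) r)
  add_smul r s f := by
    change φ.act X Y 0 n n _ (r + s) f = _
    rw [map_add]
    rfl
  zero_smul f := by
    change φ.act X Y 0 n n _ 0 f = 0
    rw [map_zero]
    rfl

/-- The graded abelian group `Hom^*(X, Y) = ⨁ n ∈ ℤ, Hom(X, Σ^n Y)`. -/
def HomStar (φ : CentralAction T 𝒜) (X Y : T) : Type v := ⨁ n : ℤ, φ.HomDeg X Y n

noncomputable instance (φ : CentralAction T 𝒜) (X Y : T) : AddCommGroup (φ.HomStar X Y) :=
  inferInstanceAs (AddCommGroup (⨁ n : ℤ, φ.HomDeg X Y n))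

/-- The action of `R` on `Hom^*(X, Y)`, as a biadditive map. -/
noncomputable def actHom (φ : CentralAction T 𝒜) (X Y : T) :
    (⨁ m, 𝒜 m) →+ (⨁ n : ℤ, φ.HomDeg X Y n) →+ (⨁ n : ℤ, φ.HomDeg X Y n) :=
  DirectSum.toAddMonoid fun m =>
    { toFun := fun r => DirectSum.toAddMonoid fun n =>
        (DirectSum.of (φ.HomDeg X Y) ((m : ℤ) + n)).comp (φ.act X Y m n _ rfl r)
      map_zero' := by
        refine DirectSum.addHom_ext fun n f => ?_
        simp
      map_add' := fun r s => by
        refine DirectSum.addHom_ext fun n f => ?_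
        simp }

theorem actHom_of (φ : CentralAction T 𝒜) (X Y : T) (m : ℕ) (r : 𝒜 m) (n k : ℤ)
    (h : (m : ℤ) + n = k) (f : φ.HomDeg X Y n) :
    φ.actHom X Y (DirectSum.of (fun m => 𝒜 m) m r) (DirectSum.of (φ.HomDeg X Y) n f) =
      DirectSum.of (φ.HomDeg X Y) k (φ.act X Y m n k h r f) := by
  subst h
  simp [actHom]

theorem actHom_one (φ : CentralAction T 𝒜) (X Y : T) :
    φ.actHom X Y 1 = AddMonoidHom.id _ := by
  refine DirectSum.addHom_ext fun n f => ?_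
  refine (φ.actHom_of X Y 0 1 n n (by simp) f).trans ?_
  rw [eq_of_heq (φ.act_one X Y n n (by simp) f)]
  rfl

theorem actHom_mul (φ : CentralAction T 𝒜) (X Y : T) (a b : ⨁ m, 𝒜 m) :
    φ.actHom X Y (a * b) = (φ.actHom X Y a).comp (φ.actHom X Y b) := by
  induction a using DirectSum.induction_on with
  | zero => simp
  | add a a' ha ha' => rw [add_mul, map_add, ha, ha', map_add, AddMonoidHom.add_comp]
  | of m r =>
    induction b using DirectSum.induction_on with
    | zero => simp
    | add b b' hb hb' => rw [mul_add, map_add, hb, hb', map_add, AddMonoidHom.comp_add]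
    | of m' s =>
      refine DirectSum.addHom_ext fun n f => ?_
      rw [DirectSum.of_mul_of, AddMonoidHom.comp_apply, φ.actHom_of X Y m' s n _ rfl,
        φ.actHom_of X Y m r _ _ rfl]
      refine (φ.actHom_of X Y (m + m') _ n ((m : ℤ) + (m' + n)) (by push_cast; ring) f).trans ?_
      congr 1
      exact φ.act_mul X Y m m' n _ _ rfl rfl _ r s f

/-- `Hom^*(X, Y)` is an `R`-module. -/
noncomputable instance (φ : CentralAction T 𝒜) (X Y : T) : Module R (φ.HomStar X Y) where
  smul r x := φ.actHom X Y (DirectSum.decompose 𝒜 r) x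
  one_smul x := by
    change φ.actHom X Y (DirectSum.decompose 𝒜 1) x = x
    rw [DirectSum.decompose_one, φ.actHom_one]
    rfl
  mul_smul r s x := by
    change φ.actHom X Y (DirectSum.decompose 𝒜 (r * s)) x = _
    rw [DirectSum.decompose_mul, φ.actHom_mul]
    rfl
  smul_zero r := map_zero (φ.actHom X Y (DirectSum.decompose 𝒜 r))
  smul_add r := map_add (φ.actHom X Y (DirectSum.decompose 𝒜 r))
  add_smul r s x := by
    change φ.actHom X Y (DirectSum.decompose 𝒜 (r + s)) x = _
    rw [DirectSum.decompose_add, map_add]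
    rfl
  zero_smul x := by
    change φ.actHom X Y (DirectSum.decompose 𝒜 0) x = 0
    rw [DirectSum.decompose_zero, map_zero]
    rfl

/-- The degree `n` component of an element of `Hom^*(X, Y)`. -/
def component (φ : CentralAction T 𝒜) (X Y : T) (n : ℤ) : φ.HomStar X Y →+ φ.HomDeg X Y n :=
  DFinsupp.evalAddMonoidHom n

theorem component_smul_eq_zero (φ : CentralAction T 𝒜) (X Y : T) (n₀ : ℤ) (r : R)
    (x : φ.HomStar X Y) (hx : ∀ n < n₀, φ.component X Y n x = 0) :
    ∀ n < n₀, φ.component X Y n (r • x) = 0 := by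
  classical
  intro n hn
  suffices H : ∀ (a : ⨁ m, 𝒜 m) (y : ⨁ n : ℤ, φ.HomDeg X Y n), (∀ n < n₀, y n = 0) →
      φ.actHom X Y a y n = 0 from H (DirectSum.decompose 𝒜 r) x hx
  intro a y hy
  induction a using DirectSum.induction_on with
  | zero => rw [map_zero]; rfl
  | add a b ha hb => rw [map_add, AddMonoidHom.add_apply, DirectSum.add_apply, ha, hb, add_zero]
  | of m s =>
    have key : φ.actHom X Y (DirectSum.of (fun m => 𝒜 m) m s) y =
        ∑ i ∈ DFinsupp.support y,
          DirectSum.of (φ.HomDeg X Y) ((m : ℤ) + i) (φ.act X Y m i _ rfl s (y i)) := by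
      conv_lhs => rw [← DirectSum.sum_support_of y]
      rw [map_sum]
      exact Finset.sum_congr rfl fun i _ => φ.actHom_of X Y m s i _ rfl (y i)
    rw [key, DirectSum.sum_apply]
    refine Finset.sum_eq_zero fun i hi => DirectSum.of_eq_of_ne _ _ _ ?_
    rintro rfl
    exact (DFinsupp.mem_support_iff.1 hi) (hy i (by omega))

/-- The `R`-submodule `Hom^{≥ n₀}(X, Y) = ⨁ n ≥ n₀, Hom(X, Σ^n Y)` of `Hom^*(X, Y)`. -/
def homGE (φ : CentralAction T 𝒜) (X Y : T) (n₀ : ℤ) : Submodule R (φ.HomStar X Y) where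
  carrier := {x | ∀ n < n₀, φ.component X Y n x = 0}
  add_mem' := fun hx hy n hn => by rw [map_add, hx n hn, hy n hn, add_zero]
  zero_mem' := fun n _ => map_zero (φ.component X Y n)
  smul_mem' := fun r x hx => φ.component_smul_eq_zero X Y n₀ r x hx

/-- The length of `Hom(X, Σ^n Y)` over `R^0`, possibly infinite. -/
noncomputable def homLength (φ : CentralAction T 𝒜) (X Y : T) (n : ℤ) : ℕ∞ :=
  Module.length (𝒜 0) (φ.HomDeg X Y n)

/-- `Hom^*(X, Y)` is eventually Noetherian and degreewise of finite length over `R^0`. -/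
structure NoethFL (φ : CentralAction T 𝒜) (X Y : T) : Prop where
  noetherian : ∃ n₀ : ℤ, IsNoetherian R (φ.homGE X Y n₀)
  length_lt_top : ∀ n : ℤ, φ.homLength X Y n < ⊤

/-- `z` in `R^d` is eventually injective on `Hom^*(X, Y)`: multiplication by `z` from
`Hom(X, Σ^n Y)` to `Hom(X, Σ^(n + d) Y)` is injective for `n ≫ 0`. -/
def EventuallyInjective (φ : CentralAction T 𝒜) (X Y : T) {d : ℕ} (z : 𝒜 d) : Prop :=
  ∀ᶠ n : ℤ in atTop, Function.Injective (φ.act X Y d n (d + n) rfl z)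

/-! ### Complexity and multiplicity -/

/-- The integer `λ^n(X, Y)`, the length of `Hom(X, Σ^n Y)` over `R^0`
(meaningful when that length is finite). -/
noncomputable def lam (φ : CentralAction T 𝒜) (X Y : T) (n : ℤ) : ℤ :=
  ((φ.homLength X Y n).toNat : ℤ)

/-- `g` is the `i`-th Hilbert polynomial of `(X, Y)`: `g(n) = λ^(dn+i)(X, Y)` for `n ≫ 0`.
There is at most one such polynomial. -/
def IsHilbertPoly (φ : CentralAction T 𝒜) (d : ℕ) (X Y : T) (i : ℕ) (g : ℚ[X]) : Prop :=
  ∀ᶠ n : ℤ in atTop, g.eval (n : ℚ) = φ.lam X Y (d * n + i)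

/-- `1 + deg g`, where the zero polynomial has degree `-1`. -/
noncomputable def degSucc (g : ℚ[X]) : ℕ :=
  if g = 0 then 0 else g.natDegree + 1

/-- `(X, Y)` has complexity `c`: the Hilbert polynomials `g_0, …, g_{d-1}` exist, and
`c = 1 + max {deg g_i}`. -/
def HasComplexity (φ : CentralAction T 𝒜) (d : ℕ) (X Y : T) (c : ℕ) : Prop :=
  ∃ g : ℕ → ℚ[X], (∀ i < d, φ.IsHilbertPoly d X Y i (g i)) ∧
    c = (Finset.range d).sup fun i => degSucc (g i)

open Classical in
/-- The complexity `cx(X, Y)`, with the value `0` if there are no Hilbert polynomials. -/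
noncomputable def cx (φ : CentralAction T 𝒜) (d : ℕ) (X Y : T) : ℕ :=
  if h : ∃ c, φ.HasComplexity d X Y c then h.choose else 0

/-- The generalized Herbrand difference
`h(X, Y)(n) = ∑_{0 ≤ i < d} (-1)^(n+i) λ^(n+i)(X, Y)` of index `d`. -/
noncomputable def herbrand (φ : CentralAction T 𝒜) (d : ℕ) (X Y : T) (n : ℤ) : ℤ :=
  ∑ i ∈ Finset.range d, ((n + i).negOnePow : ℤ) * φ.lam X Y (n + i)

/-- The difference operator `Δ^1` of index `d`. Its iterates are the operators `Δ^s`. -/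
def diffOp (d : ℕ) (f : ℤ → ℤ) (n : ℤ) : ℤ := f (n + d) - f n

/-- `λ^n(X, Y) = 0` for `n ≪ 0`. -/
def VanishesBelow (φ : CentralAction T 𝒜) (X Y : T) : Prop :=
  ∀ᶠ n : ℤ in atBot, φ.homLength X Y n = 0

/-- The `s`-multiplicity of `(X, Y)` is defined and equal to `e`. This requires `cx(X, Y) ≤ s`.
If `cx(X, Y) ≥ 1` then `e` is the value of `Δ^(s-1) h(X, Y)(n)` for all `n ≫ 0`. If
`cx(X, Y) = 0` then `s = 0`, the lengths `λ^n(X, Y)` vanish for `n ≪ 0`, and `e` is the sum of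
the `(-1)^n λ^n(X, Y)`, of which only finitely many are nonzero. -/
def IsMultiplicity (φ : CentralAction T 𝒜) (d : ℕ) (X Y : T) (s : ℕ) (e : ℤ) : Prop :=
  φ.HasComplexity d X Y (φ.cx d X Y) ∧ φ.cx d X Y ≤ s ∧
    ((1 ≤ φ.cx d X Y ∧ ∀ᶠ n : ℤ in atTop, (diffOp d)^[s - 1] (φ.herbrand d X Y) n = e) ∨
      (φ.cx d X Y = 0 ∧ s = 0 ∧ φ.VanishesBelow X Y ∧
        {n : ℤ | φ.lam X Y n ≠ 0}.Finite ∧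
        e = ∑ᶠ n : ℤ, (n.negOnePow : ℤ) * φ.lam X Y n))

open Classical in
/-- The `s`-multiplicity `e^s(X, Y)`, with the value `0` where it is not defined. -/
noncomputable def multiplicity (φ : CentralAction T 𝒜) (d : ℕ) (X Y : T) (s : ℕ) : ℤ :=
  if h : ∃ e, φ.IsMultiplicity d X Y s e then h.choose else 0

/-! ### Koszul objects -/

/-- `K` is a Koszul object `Y // z` of `z` in `R^d` on `Y`: there is a distinguished triangle
`Y ⟶ Σ^d Y ⟶ K ⟶ Σ Y` whose first morphism is `φ_Y(z)`. -/
def IsKoszulObject [HasZeroObject T] [Pretriangulated T] (φ : CentralAction T 𝒜) {d : ℕ}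
    (z : 𝒜 d) (Y K : T) : Prop :=
  ∃ (f : Y⟦(d : ℤ)⟧ ⟶ K) (g : K ⟶ Y⟦(1 : ℤ)⟧), Triangle.mk (φ.app z Y) f g ∈ distTriang T

end CentralAction

/-! ### Commutativity, prime avoidance and torsion -/

/-! Since `R` is generated by the even degrees `0` and `d`, it is commutative and lives in degrees
divisible by `d`, so no signs occur in its action.

Choice of `z`: let `N` be a Noetherian truncation of `Hom^*(X, Y)` and `I` the ideal generated by
`R^d`. The `I`-power torsion `Γ` of `N` is killed by some `I^k`, and no associated prime of `N/Γ`
contains `I`. There are infinitely many scalars in `R^0` with unit differences, so prime avoidance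
yields `z` in `R^d` outside all these primes (`exists_mem_forall_notMem`). The kernel of `z` on `N`
lies in `Γ`, which is finitely generated and killed by `R^m` for `m ≥ dk`, hence bounded in degree.
So `z` is eventually injective (`exists_eventuallyInjective`).

Let `K = Y // z`. The long exact sequence of its triangle gives `λ^n(X, K) = λ^(n+d)(X, Y) - λ^n(X,
Y) + κ_n + κ_(n+1)`, where `κ_n` is the length of the kernel of `z` in degree `n`, zero for `n ≫ 0`
(`lam_eq`). Thus `λ(X, K) = Δ λ(X, Y)` in large degrees: the degrees of the Hilbert polynomials drop
by one, and as `Δ` commutes with the alternating sum `h`, `Δ^(s-2) h(X, K) = Δ^(s-1) h(X, Y)`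
eventually. For complexity one, `(-1)^n λ^n(X, K)` is the successive difference of `h(X, Y)(n) -
(-1)^n κ_n`, and the Euler characteristic telescopes.

Hilbert polynomials exist by Noetherian induction on the ideal annihilating `Hom^*(X, Y)` in large
degrees. Passing to `K` enlarges it by `z`, and summation recovers `λ(X, Y)` from `Δ λ(X, Y)`. -/

theorem exists_infinite_pairwise_isUnit_sub {A : Type*} [CommRing A]
    (h : ContainsInfiniteField A ∨ IsLocalWithInfiniteResidueField A) :
    ∃ Λ : Set A, Λ.Infinite ∧ Λ.Pairwise fun a b => IsUnit (a - b) := by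
  obtain ⟨k, hk, hinf⟩ | ⟨hloc, hinf⟩ := h
  · refine ⟨k, Set.infinite_coe_iff.1 hinf, fun a ha b hb hab => ?_⟩
    obtain ⟨c, hc⟩ := hk.mul_inv_cancel (a := ⟨a, ha⟩ - ⟨b, hb⟩)
      (fun h => hab (congrArg Subtype.val (sub_eq_zero.1 h)))
    exact IsUnit.of_mul_eq_one _ (congrArg Subtype.val hc)
  · have := hinf (IsLocalRing.maximalIdeal A) inferInstance
    -- Representatives of distinct residue classes differ by an element outside the maximal ideal,
    -- hence by a unit.
    refine ⟨Set.range (Quotient.out : A ⧸ IsLocalRing.maximalIdeal A → A),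
      Set.infinite_range_of_injective Quotient.out_injective, ?_⟩
    rintro _ ⟨a, rfl⟩ _ ⟨b, rfl⟩ hab
    by_contra hu
    have hm : Quotient.out a - Quotient.out b ∈ IsLocalRing.maximalIdeal A := hu
    refine hab (congrArg _ ?_)
    have := (Submodule.Quotient.eq (IsLocalRing.maximalIdeal A)).2 hm
    rwa [← Submodule.Quotient.mk''_eq_mk, ← Submodule.Quotient.mk''_eq_mk,
      Quotient.out_eq', Quotient.out_eq'] at this

/-- Prime avoidance inside `D`, where unit differences replace primality, so the ideals may be
arbitrary. -/
theorem exists_mem_forall_notMem {R : Type*} [CommRing R] (D : AddSubgroup R) (Λ : Set R)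
    (hΛ : Λ.Infinite) (hu : Λ.Pairwise fun a b => IsUnit (a - b))
    (hD : ∀ a ∈ Λ, ∀ x ∈ D, a * x ∈ D) (S : Set (Ideal R)) (hS : S.Finite)
    (h : ∀ W ∈ S, ∃ x ∈ D, x ∉ W) : ∃ z ∈ D, ∀ W ∈ S, z ∉ W := by
  induction S, hS using Set.Finite.induction_on with
  | empty => exact ⟨0, D.zero_mem, by simp⟩
  | @insert W S _ hS ih =>
    obtain ⟨z, hz, hzS⟩ := ih fun V hV => h V (Set.mem_insert_of_mem _ hV)
    by_cases hzW : z ∈ W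
    · obtain ⟨v, hv, hvW⟩ := h W (Set.mem_insert _ _)
      -- Each `V` excludes at most one scalar: if `v + a z` and `v + b z` lie in `V`, so does `(a -
      -- b) z`, hence `z`, as `a - b` is a unit.
      have hbad : (⋃ V ∈ S, {a ∈ Λ | v + a * z ∈ V}).Finite := by
        refine hS.biUnion fun V hV => Set.Subsingleton.finite ?_
        rintro a ⟨ha, haV⟩ b ⟨hb, hbV⟩
        by_contra hab
        refine hzS V hV ((Ideal.unit_mul_mem_iff_mem V (hu ha hb hab)).1 ?_)
        have := V.sub_mem haV hbV
        rwa [add_sub_add_left_eq_sub, ← sub_mul] at this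
      obtain ⟨a, ha, ha'⟩ := (hΛ.sdiff hbad).nonempty
      refine ⟨v + a * z, D.add_mem hv (hD a ha z hz), ?_⟩
      rintro V (rfl | hV) hmem
      · exact hvW ((V.add_mem_iff_left (V.mul_mem_left a hzW)).1 hmem)
      · exact ha' (Set.mem_biUnion hV ⟨ha, hmem⟩)
    · exact ⟨z, hz, by rintro V (rfl | hV); exacts [hzW, hzS V hV]⟩

/-- On a Noetherian module, elements outside finitely many ideals not containing `I` have kernel
annihilated by a power of `I`. -/
theorem exists_finite_ideals_ker_smul_le {R N : Type*} [CommRing R] [IsNoetherianRing R]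
    [AddCommGroup N] [Module R N] [IsNoetherian R N] (I : Ideal R) :
    ∃ (k : ℕ) (S : Set (Ideal R)), S.Finite ∧ (∀ W ∈ S, ¬ I ≤ W) ∧
      ∀ z : R, (∀ W ∈ S, z ∉ W) → ∀ x : N, z • x = 0 → ∀ a ∈ I ^ k, a • x = 0 := by
  let Γ : ℕ →o Submodule R N := ⟨fun k => Submodule.torsionBySet R N (I ^ k : Ideal R),
    fun i j hij => Submodule.torsionBySet_le_torsionBySet_of_subset (Ideal.pow_le_pow_right hij)⟩
  obtain ⟨k, hk⟩ := monotone_stabilizes_iff_noetherian.2 ‹IsNoetherian R N› Γ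
  have memΓ : ∀ (j : ℕ) (x : N), x ∈ Γ j ↔ ∀ a ∈ I ^ j, a • x = 0 := fun j x =>
    (Submodule.mem_torsionBySet_iff _ _).trans
      ⟨fun h a ha => h ⟨a, ha⟩, fun h a => h a a.2⟩
  refine ⟨k, associatedPrimes R (N ⧸ Γ k), associatedPrimes.finite _ _, ?_, ?_⟩
  · intro W hW hIW
    obtain ⟨hprime, x, hx⟩ := isAssociatedPrime_iff.1 (AssociatedPrimes.mem_iff.1 hW)
    obtain ⟨x, rfl⟩ := (Γ k).mkQ_surjective x
    -- If `I` annihilates the class of `x`, then `I^(k+1)` kills `x`; stabilization puts `x` in `Γ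
    -- k`, so its class is zero and cannot have a proper annihilator.
    refine hprime.ne_top ((Ideal.eq_top_iff_one W).2 ?_)
    suffices hxk : x ∈ Γ k by
      rw [hx, Submodule.mem_colon_singleton, one_smul]
      simpa using hxk
    rw [hk (k + 1) (Nat.le_succ k), memΓ, pow_succ]
    intro a ha
    refine Submodule.mul_induction_on ha (fun b hb c hc => ?_) fun b c hb hc => ?_
    · have hc' := hIW hc
      rw [hx, Submodule.mem_colon_singleton, Submodule.mem_bot, ← map_smul, Submodule.mkQ_apply,
        Submodule.Quotient.mk_eq_zero] at hc'
      rw [mul_smul]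
      exact (memΓ k _).1 hc' b hb
    · rw [add_smul, hb, hc, add_zero]
  · intro z hz x hzx
    refine (memΓ k x).1 ?_
    have hreg : z ∈ (⋃ p ∈ associatedPrimes R (N ⧸ Γ k), (p : Set R))ᶜ := by
      simpa using hz
    rw [biUnion_associatedPrimes_eq_compl_regular, compl_compl] at hreg
    have h0 : z • (Γ k).mkQ x = z • (0 : N ⧸ Γ k) := by rw [← map_smul, hzx, map_zero, smul_zero]
    have := hreg h0
    simpa using this

/-! ### Graded rings generated in degrees `0` and `d` -/

section GradedRing

theorem GradedCommutative.mul_comm_of_closure_eq_top {R : Type w} [Ring R]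
    {𝒜 : ℕ → AddSubgroup R} (hcomm : GradedCommutative 𝒜) {d : ℕ} (hd : Even d)
    (hgen : Subring.closure ((𝒜 0 : Set R) ∪ (𝒜 d : Set R)) = ⊤) (r s : R) :
    r * s = s * r := by
  have hs : ∀ x ∈ (𝒜 0 : Set R) ∪ (𝒜 d : Set R), ∀ y ∈ (𝒜 0 : Set R) ∪ (𝒜 d : Set R),
      x * y = y * x := by
    rintro x (hx | hx) y (hy | hy) <;> rw [hcomm _ _ x y hx hy, Even.neg_one_pow, one_mul] <;>
      simp [hd]
  have := Subring.isMulCommutative_closure hs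
  have key := mul_comm' (⟨r, hgen ▸ Subring.mem_top r⟩ : Subring.closure _)
    ⟨s, hgen ▸ Subring.mem_top s⟩
  exact congrArg Subtype.val key

variable {R : Type w} [CommRing R] {𝒜 : ℕ → AddSubgroup R} [GradedRing 𝒜]

/-- The ring is spanned additively by products of elements of degrees `0` and `d`; a product with
`k` factors from `R^d` has degree `dk` and lies in the `k`-th power of the ideal. Speaking of
components makes the claim additive in `r`. -/
theorem decompose_mem_of_closure_eq_top {d : ℕ} (hd : 0 < d)
    (hgen : Subring.closure ((𝒜 0 : Set R) ∪ (𝒜 d : Set R)) = ⊤) (r : R) (m : ℕ) :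
    (¬ d ∣ m → (DirectSum.decompose 𝒜 r m : R) = 0) ∧
      (DirectSum.decompose 𝒜 r m : R) ∈ Ideal.span (𝒜 d : Set R) ^ (m / d) := by
  have hr : r ∈ Subring.closure ((𝒜 0 : Set R) ∪ (𝒜 d : Set R)) := hgen ▸ Subring.mem_top r
  rw [Subring.mem_closure_iff] at hr
  induction hr using AddSubgroup.closure_induction with
  | zero => simp
  | add x y _ _ hx hy =>
    rw [DirectSum.decompose_add, DirectSum.add_apply, AddSubgroup.coe_add]
    exact ⟨fun h => by rw [hx.1 h, hy.1 h, add_zero], Ideal.add_mem _ hx.2 hy.2⟩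
  | neg x _ hx =>
    rw [DirectSum.decompose_neg]
    change (_ → ((-(DirectSum.decompose 𝒜 x m) : 𝒜 m) : R) = 0) ∧
      ((-(DirectSum.decompose 𝒜 x m) : 𝒜 m) : R) ∈ _
    rw [AddSubgroup.coe_neg]
    exact ⟨fun h => by rw [hx.1 h, neg_zero], Submodule.neg_mem _ hx.2⟩
  | mem x hx =>
    obtain ⟨k, hk, hkI⟩ : ∃ k, x ∈ 𝒜 (d * k) ∧ x ∈ Ideal.span (𝒜 d : Set R) ^ k := by
      induction hx using Submonoid.closure_induction with
      | mem x hx =>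
        obtain hx | hx := hx
        · exact ⟨0, hx, by simp⟩
        · exact ⟨1, by simpa using hx, by simpa using Ideal.subset_span hx⟩
      | one => exact ⟨0, SetLike.one_mem_graded 𝒜, by simp⟩
      | mul x y _ _ hx hy =>
        obtain ⟨k, hk, hk'⟩ := hx
        obtain ⟨l, hl, hl'⟩ := hy
        exact ⟨k + l, by rw [mul_add]; exact SetLike.mul_mem_graded hk hl,
          by rw [pow_add]; exact Ideal.mul_mem_mul hk' hl'⟩
    by_cases hm : d * k = m
    · subst hm
      rw [DirectSum.decompose_of_mem_same _ hk, Nat.mul_div_cancel_left _ hd]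
      exact ⟨fun h => absurd (Dvd.intro _ rfl) h, hkI⟩
    · rw [DirectSum.decompose_of_mem_ne _ hk hm]
      exact ⟨fun _ => rfl, Submodule.zero_mem _⟩

theorem eq_zero_of_closure_eq_top {d : ℕ} (hd : 0 < d)
    (hgen : Subring.closure ((𝒜 0 : Set R) ∪ (𝒜 d : Set R)) = ⊤) {m : ℕ} (hm : ¬ d ∣ m)
    (r : 𝒜 m) : r = 0 := by
  have := (decompose_mem_of_closure_eq_top hd hgen r m).1 hm
  rwa [DirectSum.decompose_of_mem_same _ r.2, ZeroMemClass.coe_eq_zero] at this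

theorem mem_span_pow_of_closure_eq_top {d : ℕ} (hd : 0 < d)
    (hgen : Subring.closure ((𝒜 0 : Set R) ∪ (𝒜 d : Set R)) = ⊤) {m k : ℕ} (hm : d * k ≤ m)
    (r : 𝒜 m) : (r : R) ∈ Ideal.span (𝒜 d : Set R) ^ k := by
  have := (decompose_mem_of_closure_eq_top hd hgen r m).2
  rw [DirectSum.decompose_of_mem_same _ r.2] at this
  exact Ideal.pow_le_pow_right ((Nat.le_div_iff_mul_le hd).2 (by rwa [mul_comm])) this

end GradedRing

/-! ### Compatibility of the action with composition -/

namespace CentralAction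

variable {T : Type u} [Category.{v} T] [HasShift T ℤ] [Preadditive T]
  [∀ n : ℤ, (shiftFunctor T n).Additive]
  {R : Type w} [Ring R] {𝒜 : ℕ → AddSubgroup R} [GradedRing 𝒜]

theorem app_shift_one (φ : CentralAction T 𝒜) {m : ℕ} (hm : Even m) (r : 𝒜 m) (B : T) :
    φ.app r (B⟦(1 : ℤ)⟧) = (φ.app r B)⟦(1 : ℤ)⟧' ≫ (shiftFunctorComm T (m : ℤ) 1).hom.app B := by
  have h := (φ.toCenter m r).2 B
  rw [Int.negOnePow_even (m : ℤ) (by exact_mod_cast hm), one_smul] at h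
  exact h

theorem app_naturality (φ : CentralAction T 𝒜) {m : ℕ} (r : 𝒜 m) {A B : T} (f : A ⟶ B) :
    f ≫ φ.app r B = φ.app r A ≫ f⟦(m : ℤ)⟧' :=
  (φ.toCenter m r).1.naturality f

/-- Induction from `c = 1`, the defining condition of the graded center, whose sign is trivial for
even `m`. The values used later are `c = 1` and `c = d`. -/
theorem app_shift (φ : CentralAction T 𝒜) {m : ℕ} (hm : Even m) (r : 𝒜 m) (c : ℕ) (hc : 1 ≤ c)
    (B : T) : φ.app r (B⟦(c : ℤ)⟧) =
      (φ.app r B)⟦(c : ℤ)⟧' ≫ (shiftFunctorComm T (m : ℤ) c).hom.app B := by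
  induction c, hc using Nat.le_induction generalizing B with
  | base => exact φ.app_shift_one hm r B
  | succ c hc ih =>
    have h₁ := φ.app_naturality r ((shiftFunctorAdd T (c : ℤ) 1).hom.app B)
    have h₂ := shiftFunctorComm_hom_app_comp_shift_shiftFunctorAdd_hom_app (C := T) (m : ℤ) c 1 B
    have h₃ := (shiftFunctorAdd T (c : ℤ) 1).hom.naturality (φ.app r B)
    push_cast
    rw [← cancel_mono (((shiftFunctorAdd T (c : ℤ) 1).hom.app B)⟦(m : ℤ)⟧')]
    erw [← h₁, φ.app_shift_one hm r, ih B]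
    rw [Functor.map_comp, assoc, assoc, h₂]
    exact ((reassoc_of% h₃) _).symm

/-- The condition on `u` that composition with `u` commutes with the action of `R`. -/
def IsCentral (φ : CentralAction T 𝒜) {A B : T} {c : ℤ} (u : ShiftedHom A B c) : Prop :=
  ∀ (m : ℕ) (r : 𝒜 m), u.comp (φ.app r B) rfl = (φ.app r A).comp u (add_comm c m)

theorem isCentral_mk₀ (φ : CentralAction T 𝒜) {A B : T} (f : A ⟶ B) :
    φ.IsCentral (ShiftedHom.mk₀ (0 : ℤ) rfl f) := by
  intro m r
  rw [ShiftedHom.comp_mk₀, ← φ.app_naturality r f]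
  exact ShiftedHom.mk₀_comp (0 : ℤ) rfl f (φ.app r B)

/-- In even degrees there is no sign, and odd degrees contribute nothing. This makes composition
linear for the connecting morphism `K ⟶ Σ Y` and for the identity of `Σ^d Y`, read as a map to `Y`
of degree `d`. -/
theorem isCentral_of_even (φ : CentralAction T 𝒜) (h𝒜 : ∀ m, ¬ Even m → ∀ r : 𝒜 m, r = 0)
    {A B : T} {c : ℕ} (hc : 1 ≤ c) (u : ShiftedHom A B (c : ℤ)) : φ.IsCentral u := by
  intro m r
  by_cases hm : Even m
  · have h₁ := φ.app_naturality r u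
    rw [φ.app_shift hm r c hc] at h₁
    rw [ShiftedHom.comp, ShiftedHom.comp, ← reassoc_of% h₁]
    rw [shiftFunctorComm_eq T (m : ℤ) c _ rfl]
    simp
  · have : r = 0 := h𝒜 m hm r
    have h₀ : ∀ B : T, φ.app (0 : 𝒜 m) B = 0 := fun B => by
      simp only [app, map_zero]
      rfl
    rw [this, h₀, h₀, ShiftedHom.comp_zero, ShiftedHom.zero_comp]

/-- Composition with `u : A ⟶ Σ^c B`, as a map `Hom(X, Σ^n A) ⟶ Hom(X, Σ^(c + n) B)`. -/
noncomputable def compHom (φ : CentralAction T 𝒜) (X : T) {A B : T} {c : ℤ}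
    (u : ShiftedHom A B c) (n k : ℤ) (h : c + n = k) : φ.HomDeg X A n →+ φ.HomDeg X B k where
  toFun f := ShiftedHom.comp (X := X) (Y := A) (Z := B) f u h
  map_zero' := ShiftedHom.zero_comp X n u h
  map_add' f g := ShiftedHom.add_comp (X := X) (Y := A) f g u h

theorem act_apply (φ : CentralAction T 𝒜) (X A : T) (m : ℕ) (r : 𝒜 m) (n k : ℤ)
    (h : (m : ℤ) + n = k) (f : φ.HomDeg X A n) :
    φ.act X A m n k h r f = φ.compHom X (φ.app r A) n k h f := rfl

theorem compHom_compHom (φ : CentralAction T 𝒜) (X : T) {A B C : T} {c c' e : ℤ}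
    (u : ShiftedHom A B c) (u' : ShiftedHom B C c') (n k l : ℤ) (h : c + n = k) (h' : c' + k = l)
    (he : c' + c = e) (f : φ.HomDeg X A n) :
    φ.compHom X u' k l h' (φ.compHom X u n k h f) =
      φ.compHom X (u.comp u' he) n l (by omega) f :=
  ShiftedHom.comp_assoc (X := X) (Y := A) f u u' h he (by omega)

theorem act_compHom (φ : CentralAction T 𝒜) (X : T) {A B : T} {c : ℤ} {u : ShiftedHom A B c}
    (hu : φ.IsCentral u) (m : ℕ) (r : 𝒜 m) (n k p l : ℤ) (h : c + n = k) (h₁ : (m : ℤ) + k = l)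
    (h₂ : (m : ℤ) + n = p) (h₃ : c + p = l) (f : φ.HomDeg X A n) :
    φ.act X B m k l h₁ r (φ.compHom X u n k h f) =
      φ.compHom X u p l h₃ (φ.act X A m n p h₂ r f) := by
  rw [act_apply, act_apply, φ.compHom_compHom X u _ n k l h h₁ rfl,
    φ.compHom_compHom X _ u n p l h₂ h₃ (add_comm c m), hu m r]

/-- Composition with a central `u` as a linear map over `R^0`. -/
noncomputable def compLin (φ : CentralAction T 𝒜) (X : T) {A B : T} {c : ℤ}
    {u : ShiftedHom A B c} (hu : φ.IsCentral u) (n k : ℤ) (h : c + n = k) :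
    φ.HomDeg X A n →ₗ[𝒜 0] φ.HomDeg X B k :=
  { φ.compHom X u n k h with
    map_smul' := fun r f =>
      (φ.act_compHom X hu 0 r n k n k h (by simp) (by simp) h f).symm }

theorem smul_of (φ : CentralAction T 𝒜) (X A : T) (m : ℕ) (r : 𝒜 m) (n k : ℤ)
    (h : (m : ℤ) + n = k) (f : φ.HomDeg X A n) :
    (r : R) • (show φ.HomStar X A from DirectSum.of (φ.HomDeg X A) n f) =
      (show φ.HomStar X A from DirectSum.of (φ.HomDeg X A) k (φ.act X A m n k h r f)) := by
  change φ.actHom X A (DirectSum.decompose 𝒜 (r : R)) _ = _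
  rw [DirectSum.decompose_coe]
  exact φ.actHom_of X A m r n k h f

/-- Composition with `u` on `Hom^*(X, A)`, as an additive map. -/
noncomputable def starHom (φ : CentralAction T 𝒜) (X : T) {A B : T} {c : ℤ}
    (u : ShiftedHom A B c) : (⨁ n : ℤ, φ.HomDeg X A n) →+ (⨁ n : ℤ, φ.HomDeg X B n) :=
  DirectSum.toAddMonoid fun n =>
    (DirectSum.of (φ.HomDeg X B) (c + n)).comp (φ.compHom X u n (c + n) rfl)

theorem starHom_of (φ : CentralAction T 𝒜) (X : T) {A B : T} {c : ℤ}
    (u : ShiftedHom A B c) (n k : ℤ) (h : c + n = k) (f : φ.HomDeg X A n) :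
    φ.starHom X u (DirectSum.of (φ.HomDeg X A) n f) =
      DirectSum.of (φ.HomDeg X B) k (φ.compHom X u n k h f) := by
  subst h
  simp [starHom]

theorem starHom_apply (φ : CentralAction T 𝒜) (X : T) {A B : T} {c : ℤ}
    (u : ShiftedHom A B c) (n k : ℤ) (h : c + n = k) (x : ⨁ n : ℤ, φ.HomDeg X A n) :
    φ.starHom X u x k = φ.compHom X u n k h (x n) := by
  induction x using DirectSum.induction_on with
  | zero => rw [map_zero, DirectSum.zero_apply, DirectSum.zero_apply, map_zero]
  | add x y hx hy => rw [map_add, DirectSum.add_apply, DirectSum.add_apply, map_add, hx, hy]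
  | of i f =>
    rw [φ.starHom_of X u i (c + i) rfl]
    by_cases hi : i = n
    · subst hi
      subst h
      rw [DirectSum.of_eq_same, DirectSum.of_eq_same]
    · rw [DirectSum.of_eq_of_ne _ _ _ (by omega), DirectSum.of_eq_of_ne _ _ _ (by omega), map_zero]

/-- Composition with a central `u` is an `R`-linear map `Hom^*(X, A) ⟶ Hom^*(X, B)`. -/
noncomputable def starMap (φ : CentralAction T 𝒜) (X : T) {A B : T} {c : ℤ}
    {u : ShiftedHom A B c} (hu : φ.IsCentral u) : φ.HomStar X A →ₗ[R] φ.HomStar X B :=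
  { φ.starHom X u with
    map_smul' := by
      intro r x
      change φ.starHom X u (φ.actHom X A (DirectSum.decompose 𝒜 r) x) =
        φ.actHom X B (DirectSum.decompose 𝒜 r) (φ.starHom X u x)
      generalize DirectSum.decompose 𝒜 r = a
      suffices H : (φ.starHom X u).comp (φ.actHom X A a) = (φ.actHom X B a).comp (φ.starHom X u) from
        DFunLike.congr_fun H x
      induction a using DirectSum.induction_on with
      | zero => rw [map_zero, map_zero, AddMonoidHom.comp_zero, AddMonoidHom.zero_comp]
      | add a b ha hb =>
        rw [map_add, map_add, AddMonoidHom.comp_add, AddMonoidHom.add_comp, ha, hb]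
      | of m r =>
        refine DirectSum.addHom_ext fun n f => ?_
        rw [AddMonoidHom.comp_apply, AddMonoidHom.comp_apply, φ.actHom_of X A m r n _ rfl,
          φ.starHom_of X u n _ rfl, φ.actHom_of X B m r _ _ rfl,
          φ.starHom_of X u (m + n) (m + (c + n)) (by omega),
          φ.act_compHom X hu m r n _ (m + n) _ rfl rfl rfl (by omega)] }

theorem component_starMap (φ : CentralAction T 𝒜) (X : T) {A B : T} {c : ℤ}
    {u : ShiftedHom A B c} (hu : φ.IsCentral u) (n k : ℤ) (h : c + n = k) (x : φ.HomStar X A) :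
    φ.component X B k (φ.starMap X hu x) = φ.compHom X u n k h (φ.component X A n x) :=
  φ.starHom_apply X u n k h x

theorem homStar_ext (φ : CentralAction T 𝒜) {X A : T} {x y : φ.HomStar X A}
    (h : ∀ n, φ.component X A n x = φ.component X A n y) : x = y :=
  DFinsupp.ext h

theorem starMap_mem_homGE (φ : CentralAction T 𝒜) (X : T) {A B : T} {c : ℤ}
    {u : ShiftedHom A B c} (hu : φ.IsCentral u) {n₀ : ℤ} {x : φ.HomStar X A}
    (hx : x ∈ φ.homGE X A n₀) : φ.starMap X hu x ∈ φ.homGE X B (c + n₀) := by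
  intro k hk
  rw [φ.component_starMap X hu (k - c) k (by omega), hx _ (by omega), map_zero]

/-- The element of `Hom^*(X, A)` concentrated in degree `n`. -/
noncomputable def single (φ : CentralAction T 𝒜) (X A : T) (n : ℤ) :
    φ.HomDeg X A n →+ φ.HomStar X A :=
  DirectSum.of (φ.HomDeg X A) n

theorem component_single_same (φ : CentralAction T 𝒜) (X A : T) (n : ℤ) (f : φ.HomDeg X A n) :
    φ.component X A n (φ.single X A n f) = f :=
  DirectSum.of_eq_same _ _

theorem component_single_of_ne (φ : CentralAction T 𝒜) (X A : T) {n k : ℤ} (h : k ≠ n)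
    (f : φ.HomDeg X A n) : φ.component X A k (φ.single X A n f) = 0 :=
  DirectSum.of_eq_of_ne _ _ _ h

theorem smul_single (φ : CentralAction T 𝒜) (X A : T) (m : ℕ) (r : 𝒜 m) (n k : ℤ)
    (h : (m : ℤ) + n = k) (f : φ.HomDeg X A n) :
    (r : R) • φ.single X A n f = φ.single X A k (φ.act X A m n k h r f) :=
  φ.smul_of X A m r n k h f

theorem exists_component_eq_zero (φ : CentralAction T 𝒜) {X A : T} (x : φ.HomStar X A) :
    ∃ D : ℤ, ∀ n > D, φ.component X A n x = 0 := by
  classical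
  change ∃ D : ℤ, ∀ n > D, (show ⨁ n : ℤ, φ.HomDeg X A n from x) n = 0
  obtain ⟨D, hD⟩ := (DFinsupp.support (show ⨁ n : ℤ, φ.HomDeg X A n from x)).bddAbove
  refine ⟨D, fun n hn => ?_⟩
  by_contra h
  exact absurd (hD (DFinsupp.mem_support_iff.2 h)) (by simpa using hn)

/-- Multiplication by an element of degree `m` raises the degree by `m`. -/
theorem component_smul (φ : CentralAction T 𝒜) (X A : T) (m : ℕ) (r : 𝒜 m) (n k : ℤ)
    (h : (m : ℤ) + n = k) (x : φ.HomStar X A) :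
    φ.component X A k ((r : R) • x) = φ.act X A m n k h r (φ.component X A n x) := by
  change φ.actHom X A (DirectSum.decompose 𝒜 (r : R)) x k = _
  rw [DirectSum.decompose_coe]
  have : φ.actHom X A (DirectSum.of (fun m => 𝒜 m) m r) = φ.starHom X (φ.app r A) :=
    DirectSum.addHom_ext fun n f => by
      rw [φ.actHom_of X A m r n _ rfl, φ.starHom_of X _ n _ rfl]
      rfl
  rw [this]
  exact φ.starHom_apply X _ n k h x

end CentralAction

/-! ### Eventually injective elements -/

namespace CentralAction

section Injective

variable {T : Type u} [Category.{v} T] [HasShift T ℤ] [Preadditive T]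
  [∀ n : ℤ, (shiftFunctor T n).Additive]
  {R : Type w} [CommRing R] {𝒜 : ℕ → AddSubgroup R} [GradedRing 𝒜]

/-- If the generators of a submodule are annihilated by all elements of large degree, then its
elements are bounded above in degree. -/
theorem component_eq_zero_of_mem_span (φ : CentralAction T 𝒜) (X A : T) (M : ℕ) (D : ℤ)
    (t : Set (φ.HomStar X A)) (ht : ∀ x ∈ t, ∀ n > D, φ.component X A n x = 0)
    (htM : ∀ x ∈ t, ∀ m ≥ M, ∀ r : 𝒜 m, (r : R) • x = 0) (x : φ.HomStar X A)
    (hx : x ∈ Submodule.span R t) (n : ℤ) (hn : D + M < n) : φ.component X A n x = 0 := by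
  -- Quantifying over all multiples of `x` makes the scalar case of the span induction immediate.
  suffices H : ∀ r : R, φ.component X A n (r • x) = 0 by simpa using H 1
  induction hx using Submodule.span_induction with
  | zero => intro r; rw [smul_zero, map_zero]
  | add x y _ _ hx hy => intro r; rw [smul_add, map_add, hx, hy, add_zero]
  | smul a x _ hx => intro r; rw [smul_smul, hx]
  | mem x hx =>
    intro r
    induction r using DirectSum.Decomposition.inductionOn 𝒜 with
    | zero => rw [zero_smul, map_zero]
    | add a b ha hb => rw [add_smul, map_add, ha, hb, add_zero]
    | @homogeneous m r =>
      by_cases hm : M ≤ m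
      · rw [htM x hx m hm r, map_zero]
      · rw [φ.component_smul X A m r (n - m) n (by omega), ht x hx _ (by omega), map_zero]

theorem exists_eventuallyInjective [IsNoetherianRing R] (φ : CentralAction T 𝒜) (X Y : T) {d : ℕ}
    (hd : 0 < d) (hgen : Subring.closure ((𝒜 0 : Set R) ∪ (𝒜 d : Set R)) = ⊤)
    (hR₀ : ContainsInfiniteField (𝒜 0) ∨ IsLocalWithInfiniteResidueField (𝒜 0))
    (h : ∃ n₀ : ℤ, IsNoetherian R (φ.homGE X Y n₀)) :
    ∃ z : 𝒜 d, φ.EventuallyInjective X Y z := by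
  obtain ⟨n₀, hn₀⟩ := h
  obtain ⟨k, S, hS, hSI, hker⟩ :=
    exists_finite_ideals_ker_smul_le (N := φ.homGE X Y n₀) (Ideal.span (𝒜 d : Set R))
  obtain ⟨Λ, hΛ, hu⟩ := exists_infinite_pairwise_isUnit_sub hR₀
  obtain ⟨z, hz, hzS⟩ := exists_mem_forall_notMem (𝒜 d) ((fun a : 𝒜 0 => (a : R)) '' Λ)
    (hΛ.image Subtype.val_injective.injOn)
    (by
      rintro _ ⟨a, ha, rfl⟩ _ ⟨b, hb, rfl⟩ hab
      obtain ⟨c, hc⟩ := hu ha hb (fun h => hab (by rw [h]))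
      have h₁ : ((c * c⁻¹ : (𝒜 0)ˣ) : 𝒜 0) = 1 := by rw [mul_inv_cancel, Units.val_one]
      rw [Units.val_mul, hc] at h₁
      exact IsUnit.of_mul_eq_one (((c⁻¹ : (𝒜 0)ˣ) : 𝒜 0) : R) (congrArg Subtype.val h₁))
    (by
      rintro _ ⟨a, _, rfl⟩ x hx
      simpa using SetLike.mul_mem_graded a.2 hx)
    S hS (fun W hW => by
      by_contra! hcon
      exact hSI W hW (Ideal.span_le.2 hcon))
  obtain ⟨t, ht⟩ := (isNoetherian_def.1 hn₀)
    (Submodule.torsionBySet R (φ.homGE X Y n₀) (Ideal.span (𝒜 d : Set R) ^ k : Ideal R))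
  have htor : ∀ x ∈ t, ∀ a ∈ Ideal.span (𝒜 d : Set R) ^ k, a • x = 0 := fun x hx a ha =>
    (Submodule.mem_torsionBySet_iff _ _).1 (ht ▸ Submodule.subset_span hx) ⟨a, ha⟩
  have hD : ∃ D : ℤ, ∀ x ∈ t, ∀ n > D, φ.component X Y n x = 0 := by
    choose D hD using fun x : φ.homGE X Y n₀ => φ.exists_component_eq_zero (x : φ.HomStar X Y)
    obtain ⟨B, hB⟩ := (t.image D).bddAbove
    exact ⟨B, fun x hx n hn => hD x n
      (lt_of_le_of_lt (hB (by exact_mod_cast Finset.mem_image_of_mem D hx)) hn)⟩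
  obtain ⟨D, hD⟩ := hD
  refine ⟨⟨z, hz⟩, ?_⟩
  -- The generators of the torsion live in degrees at most `D`, and `R^m` kills them once `m ≥ dk`;
  -- so the torsion vanishes above `D + dk`.
  filter_upwards [eventually_ge_atTop n₀, eventually_gt_atTop (D + (d * k : ℕ))] with n hn hnD
  refine (injective_iff_map_eq_zero _).2 fun f hf => ?_
  have hmem : φ.single X Y n f ∈ φ.homGE X Y n₀ := fun i hi =>
    φ.component_single_of_ne X Y (by omega) f
  have hzero : z • (⟨φ.single X Y n f, hmem⟩ : φ.homGE X Y n₀) = 0 := by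
    apply Subtype.ext
    change z • φ.single X Y n f = 0
    rw [φ.smul_single X Y d ⟨z, hz⟩ n _ rfl, hf, map_zero]
  have htors := (Submodule.mem_torsionBySet_iff (R := R)
    (s := (Ideal.span (𝒜 d : Set R) ^ k : Ideal R)) _).2
    fun a => hker z hzS _ hzero a a.2
  rw [← ht] at htors
  have hspan := Submodule.mem_map_of_mem (f := (φ.homGE X Y n₀).subtype) htors
  rw [Submodule.map_span] at hspan
  have := φ.component_eq_zero_of_mem_span X Y (d * k) D _
    (by rintro _ ⟨x, hx, rfl⟩; exact hD x hx)
    (by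
      rintro _ ⟨x, hx, rfl⟩ m hm r
      rw [← map_smul, htor x hx _ (mem_span_pow_of_closure_eq_top hd hgen hm r), map_zero])
    _ hspan n hnD
  simpa [φ.component_single_same] using this

end Injective

end CentralAction

/-! ### The long exact sequence of a distinguished triangle -/

section Triangle

variable {T : Type u} [Category.{v} T] [HasZeroObject T] [HasShift T ℤ] [Preadditive T]
  [∀ n : ℤ, (shiftFunctor T n).Additive] [Pretriangulated T]
  {X A B C : T} {a : A ⟶ B} {b : B ⟶ C} {c : C ⟶ A⟦(1 : ℤ)⟧}

theorem exists_eq_comp_shift_mor₁ (h : Triangle.mk a b c ∈ distTriang T) (n : ℤ)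
    (f : X ⟶ B⟦n⟧) (hf : f ≫ b⟦n⟧' = 0) : ∃ g : X ⟶ A⟦n⟧, f = g ≫ a⟦n⟧' := by
  obtain ⟨g, hg⟩ : ∃ g : X ⟶ A⟦n⟧, f = g ≫ (n.negOnePow • a⟦n⟧') :=
    Triangle.coyoneda_exact₂ _ (Triangle.shift_distinguished _ h n) f (by
    change f ≫ (n.negOnePow • b⟦n⟧') = 0
    rw [Linear.comp_units_smul, hf, smul_zero])
  -- The sign `(-1)^n` on the morphisms of the shifted triangle is absorbed into the lift.
  refine ⟨n.negOnePow • g, hg.trans ?_⟩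
  rw [Linear.comp_units_smul, Linear.units_smul_comp]

theorem exists_eq_comp_shift_mor₂ (h : Triangle.mk a b c ∈ distTriang T) (n : ℤ)
    (f : X ⟶ C⟦n⟧) (hf : f ≫ c⟦n⟧' = 0) : ∃ g : X ⟶ B⟦n⟧, f = g ≫ b⟦n⟧' := by
  obtain ⟨g, hg⟩ : ∃ g : X ⟶ B⟦n⟧, f = g ≫ (n.negOnePow • b⟦n⟧') :=
    Triangle.coyoneda_exact₃ _ (Triangle.shift_distinguished _ h n) f (by
    change f ≫ (n.negOnePow • c⟦n⟧' ≫ (shiftFunctorComm T 1 n).hom.app A) = 0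
    rw [Linear.comp_units_smul, ← assoc, hf, zero_comp, smul_zero])
  refine ⟨n.negOnePow • g, hg.trans ?_⟩
  rw [Linear.comp_units_smul, Linear.units_smul_comp]

theorem exists_eq_comp_mor₃ (h : Triangle.mk a b c ∈ distTriang T) (n k : ℤ) (hk : 1 + n = k)
    (f : X ⟶ A⟦k⟧) (hf : f ≫ a⟦k⟧' = 0) :
    ∃ g : X ⟶ C⟦n⟧, f = ShiftedHom.comp (Y := C) (Z := A) g c hk := by
  have hk' : n + 1 = k := by omega
  have hnat := (shiftFunctorAdd' T n 1 k hk').hom.naturality a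
  obtain ⟨g, hg⟩ : ∃ g : X ⟶ C⟦n⟧, f ≫ (shiftFunctorAdd' T n 1 k hk').hom.app A =
      g ≫ (n.negOnePow • c⟦n⟧' ≫ (shiftFunctorComm T 1 n).hom.app A) :=
    Triangle.coyoneda_exact₁ _ (Triangle.shift_distinguished _ h n) _ (by
      change (f ≫ _) ≫ (n.negOnePow • a⟦n⟧')⟦(1 : ℤ)⟧' = 0
      rw [Functor.map_units_smul, Linear.comp_units_smul, assoc]
      erw [← hnat]
      rw [reassoc_of% hf, zero_comp, smul_zero])
  refine ⟨n.negOnePow • g, ?_⟩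
  rw [shiftFunctorComm_eq T 1 n k hk, Linear.comp_units_smul] at hg
  rw [ShiftedHom.comp, Linear.units_smul_comp,
    ← cancel_mono ((shiftFunctorAdd' T n 1 k hk').hom.app A), hg, Linear.units_smul_comp]
  simp

theorem comp_shift_mor₁_mor₂ (h : Triangle.mk a b c ∈ distTriang T) (n : ℤ) :
    a⟦n⟧' ≫ b⟦n⟧' = 0 := by
  have : a ≫ b = 0 := comp_distTriang_mor_zero₁₂ _ h
  rw [← Functor.map_comp, this, Functor.map_zero]

theorem comp_shift_mor₂_mor₃ (h : Triangle.mk a b c ∈ distTriang T) (n : ℤ) :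
    b⟦n⟧' ≫ c⟦n⟧' = 0 := by
  have : b ≫ c = 0 := comp_distTriang_mor_zero₂₃ _ h
  rw [← Functor.map_comp, this, Functor.map_zero]

theorem comp_mor₃_mor₁ (h : Triangle.mk a b c ∈ distTriang T) (n k : ℤ) (hk : 1 + n = k)
    (g : X ⟶ C⟦n⟧) : ShiftedHom.comp (Y := C) (Z := A) g c hk ≫ a⟦k⟧' = 0 := by
  have hnat := (shiftFunctorAdd' T 1 n k hk).inv.naturality a
  have : c ≫ a⟦(1 : ℤ)⟧' = 0 := comp_distTriang_mor_zero₃₁ _ h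
  rw [ShiftedHom.comp, assoc, assoc, ← hnat]
  change g ≫ c⟦n⟧' ≫ (a⟦(1 : ℤ)⟧')⟦n⟧' ≫ _ = 0
  rw [← Functor.map_comp_assoc, this, Functor.map_zero, zero_comp, comp_zero]

end Triangle

/-! ### Exact sequences for a Koszul object. -/

namespace CentralAction

section Shift

variable {T : Type u} [Category.{v} T] [HasShift T ℤ] [Preadditive T]
  [∀ n : ℤ, (shiftFunctor T n).Additive]
  {R : Type w} [Ring R] {𝒜 : ℕ → AddSubgroup R} [GradedRing 𝒜]

variable (φ : CentralAction T 𝒜) (X Y : T)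

theorem compHom_id_bijective (d : ℤ) (n k : ℤ) (h : d + n = k) :
    Function.Bijective (φ.compHom X (A := Y⟦d⟧) (B := Y) (c := d) (𝟙 _) n k h) := by
  have H : ∀ f : X ⟶ (Y⟦d⟧)⟦n⟧, φ.compHom X (A := Y⟦d⟧) (B := Y) (c := d) (𝟙 _) n k h f =
      f ≫ (shiftFunctorAdd' T d n k h).inv.app Y := fun f => by
    change f ≫ (𝟙 (Y⟦d⟧))⟦n⟧' ≫ _ = _
    rw [CategoryTheory.Functor.map_id, id_comp]
  refine ⟨fun f g hfg => ?_, fun g => ⟨g ≫ (shiftFunctorAdd' T d n k h).hom.app Y, ?_⟩⟩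
  · have h' := hfg
    erw [H, H] at h'
    exact (cancel_mono _).1 h'
  · refine (H _).trans ((assoc _ _ _).trans ?_)
    rw [Iso.hom_inv_id_app]
    exact comp_id (X := X) g

/-- Composition with `α : Y ⟶ Σ^d Y` followed by the shift is composition with `α`, seen as
having degree `d`. -/
theorem compHom_id_compHom_mk₀ (d : ℤ) (α : Y ⟶ Y⟦d⟧) (n k : ℤ) (h : d + n = k)
    (f : φ.HomDeg X Y n) :
    φ.compHom X (A := Y⟦d⟧) (B := Y) (c := d) (𝟙 _) n k h
      (φ.compHom X (ShiftedHom.mk₀ (0 : ℤ) rfl α) n n (zero_add n) f) =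
    φ.compHom X (A := Y) (B := Y) (c := d) α n k h f := by
  rw [φ.compHom_compHom X _ _ n n k _ _ (add_zero d), ShiftedHom.mk₀_comp, comp_id]

theorem compHom_mk₀_apply {A B : T} (α : A ⟶ B) (n : ℤ) (f : φ.HomDeg X A n) :
    φ.compHom X (ShiftedHom.mk₀ (0 : ℤ) rfl α) n n (zero_add n) f =
      (show X ⟶ A⟦n⟧ from f) ≫ α⟦n⟧' :=
  ShiftedHom.comp_mk₀ (X := X) (Y := A) f 0 rfl α

/-- Reconciles two readings of multiplication by `z`: the action, which raises the degree by `d`,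
and composition with the degree-zero morphism `Y ⟶ Σ^d Y` of the triangle. They differ by the
bijection induced by the identity of `Σ^d Y`. -/
theorem act_eq_zero_iff_comp_shift {d : ℕ} (z : 𝒜 d) (n k : ℤ)
    (h : (d : ℤ) + n = k) (x : φ.HomDeg X Y n) :
    φ.act X Y d n k h z x = 0 ↔
      φ.compHom X (ShiftedHom.mk₀ (0 : ℤ) rfl (φ.app z Y)) n n (zero_add n) x = 0 := by
  rw [act_apply, ← φ.compHom_id_compHom_mk₀ X Y d (φ.app z Y) n k h,
    map_eq_zero_iff _ (φ.compHom_id_bijective X Y d n k h).1]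

end Shift

variable {T : Type u} [Category.{v} T] [HasZeroObject T] [HasShift T ℤ] [Preadditive T]
  [∀ n : ℤ, (shiftFunctor T n).Additive] [Pretriangulated T]
  {R : Type w} [Ring R] {𝒜 : ℕ → AddSubgroup R} [GradedRing 𝒜]

section Koszul

variable {φ : CentralAction T 𝒜} {X Y K : T} {d : ℕ} {z : 𝒜 d} {f : Y⟦(d : ℤ)⟧ ⟶ K}
  {g : K ⟶ Y⟦(1 : ℤ)⟧}

theorem koszul_exact₂ (hK : Triangle.mk (φ.app z Y) f g ∈ distTriang T) (n : ℤ) :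
    Function.Exact
      (φ.compHom X (ShiftedHom.mk₀ (0 : ℤ) rfl (φ.app z Y)) n n (zero_add n))
      (φ.compHom X (ShiftedHom.mk₀ (0 : ℤ) rfl f) n n (zero_add n)) := by
  intro x
  rw [compHom_mk₀_apply]
  constructor
  · intro hx
    obtain ⟨y, hy⟩ := exists_eq_comp_shift_mor₁ hK n x hx
    exact ⟨y, (φ.compHom_mk₀_apply X _ n y).trans hy.symm⟩
  · rintro ⟨y, rfl⟩
    rw [compHom_mk₀_apply]
    exact (assoc _ _ _).trans ((congrArg _ (comp_shift_mor₁_mor₂ hK n)).trans comp_zero)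

theorem koszul_exact₃ (hK : Triangle.mk (φ.app z Y) f g ∈ distTriang T) (n k : ℤ)
    (h : 1 + n = k) :
    Function.Exact
      (φ.compHom X (ShiftedHom.mk₀ (0 : ℤ) rfl f) n n (zero_add n))
      (φ.compHom X (A := K) (B := Y) (c := 1) g n k h) := by
  intro x
  constructor
  · intro hx
    change (show X ⟶ K⟦n⟧ from x) ≫ g⟦n⟧' ≫ _ = 0 at hx
    rw [← assoc] at hx
    have hx' : (show X ⟶ K⟦n⟧ from x) ≫ g⟦n⟧' = 0 := by
      refine (cancel_mono ((shiftFunctorAdd' T 1 n k h).inv.app Y)).1 (hx.trans zero_comp.symm)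
    obtain ⟨y, hy⟩ := exists_eq_comp_shift_mor₂ hK n x hx'
    exact ⟨y, (φ.compHom_mk₀_apply X _ n y).trans hy.symm⟩
  · rintro ⟨y, rfl⟩
    rw [compHom_mk₀_apply]
    change ((show X ⟶ (Y⟦(d : ℤ)⟧)⟦n⟧ from y) ≫ f⟦n⟧') ≫ g⟦n⟧' ≫ _ = 0
    rw [assoc, ← assoc (f⟦n⟧'), comp_shift_mor₂_mor₃ hK n, zero_comp, comp_zero]

theorem koszul_exact₁ (hK : Triangle.mk (φ.app z Y) f g ∈ distTriang T) (n k l : ℤ)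
    (h : 1 + n = k) (h' : (d : ℤ) + k = l) :
    Function.Exact (φ.compHom X (A := K) (B := Y) (c := 1) g n k h) (φ.act X Y d k l h' z) := by
  intro x
  rw [φ.act_eq_zero_iff_comp_shift X Y z k l h', compHom_mk₀_apply]
  constructor
  · intro hx
    obtain ⟨y, hy⟩ := exists_eq_comp_mor₃ hK n k h x hx
    exact ⟨y, hy.symm⟩
  · rintro ⟨y, rfl⟩
    exact comp_mor₃_mor₁ hK n k h y

end Koszul

end CentralAction

/-! ### Lengths in exact sequences -/

theorem Module.length_eq_length_ker_add_length_range {A M N : Type*} [Ring A] [AddCommGroup M]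
    [AddCommGroup N] [Module A M] [Module A N] (f : M →ₗ[A] N) :
    Module.length A M = Module.length A (LinearMap.ker f) + Module.length A (LinearMap.range f) :=
  Module.length_eq_add_of_exact (LinearMap.ker f).subtype f.rangeRestrict
    (Submodule.subtype_injective _) f.surjective_rangeRestrict
    (LinearMap.exact_iff.2 (by rw [LinearMap.ker_rangeRestrict, Submodule.range_subtype]))

section FiveTerms

variable {A M N P Q S : Type*} [Ring A] [AddCommGroup M] [AddCommGroup N] [AddCommGroup P]
  [AddCommGroup Q] [AddCommGroup S] [Module A M] [Module A N] [Module A P] [Module A Q]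
  [Module A S] {α : M →ₗ[A] N} {β : N →ₗ[A] P} {γ : P →ₗ[A] Q} {δ : Q →ₗ[A] S}

/-- Split each middle term into kernel and image. The additive form avoids subtracting possibly
infinite lengths. -/
theorem Module.length_add_length_of_exact (h₁ : Function.Exact α β) (h₂ : Function.Exact β γ)
    (h₃ : Function.Exact γ δ) :
    Module.length A P + Module.length A M =
      Module.length A N + (Module.length A (LinearMap.ker α) + Module.length A (LinearMap.ker δ)) := by
  rw [Module.length_eq_length_ker_add_length_range γ, Module.length_eq_length_ker_add_length_range α,
    Module.length_eq_length_ker_add_length_range β, LinearMap.exact_iff.1 h₁,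
    LinearMap.exact_iff.1 h₂, LinearMap.exact_iff.1 h₃]
  abel

theorem Module.length_le_add_of_exact (h₂ : Function.Exact β γ) :
    Module.length A P ≤ Module.length A N + Module.length A Q := by
  rw [Module.length_eq_length_ker_add_length_range γ, LinearMap.exact_iff.1 h₂]
  exact add_le_add (Module.length_le_of_surjective _ β.surjective_rangeRestrict)
    (Module.length_le_of_injective (LinearMap.range γ).subtype (Submodule.subtype_injective _))

end FiveTerms

/-! ### Eventual annihilators, lifting of elements, and the shift by `d`. -/

namespace CentralAction

variable {T : Type u} [Category.{v} T] [HasShift T ℤ] [Preadditive T]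
  [∀ n : ℤ, (shiftFunctor T n).Additive]
  {R : Type w} [Ring R] {𝒜 : ℕ → AddSubgroup R} [GradedRing 𝒜]

/-- The ideal of elements annihilating `Hom^{≥ n}(X, A)` for `n ≫ 0`. -/
def eventualAnnihilator (φ : CentralAction T 𝒜) (X A : T) : Ideal R where
  carrier := {r | ∃ n₀ : ℤ, ∀ x ∈ φ.homGE X A n₀, r • x = 0}
  zero_mem' := ⟨0, fun x _ => zero_smul R x⟩
  add_mem' := by
    rintro a b ⟨m, hm⟩ ⟨n, hn⟩
    refine ⟨max m n, fun x hx => ?_⟩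
    rw [add_smul, hm x fun i hi => hx i (lt_max_of_lt_left hi),
      hn x fun i hi => hx i (lt_max_of_lt_right hi), add_zero]
  smul_mem' := by
    rintro c r ⟨n, hn⟩
    refine ⟨n, fun x hx => ?_⟩
    rw [smul_eq_mul, mul_smul, hn x hx, smul_zero]

theorem exists_starMap_eq (φ : CentralAction T 𝒜) (X : T) {A B : T}
    {u : ShiftedHom A B (0 : ℤ)} (hu : φ.IsCentral u) (n₁ : ℤ)
    (h : ∀ n ≥ n₁, Function.Surjective (φ.compHom X u n n (zero_add n)))
    (x : φ.HomStar X B) (hx : x ∈ φ.homGE X B n₁) :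
    ∃ y ∈ φ.homGE X A n₁, φ.starMap X hu y = x := by
  classical
  -- Lifting zero components to zero keeps the support of the lift finite.
  have h' : ∀ n, ∃ y : φ.HomDeg X A n,
      φ.compHom X u n n (zero_add n) y = φ.component X B n x ∧
        (φ.component X B n x = 0 → y = 0) := by
    intro n
    by_cases hn : φ.component X B n x = 0
    · exact ⟨0, by rw [map_zero, hn], fun _ => rfl⟩
    · obtain ⟨y, hy⟩ := h n (not_lt.1 fun hlt => hn (hx n hlt)) (φ.component X B n x)
      exact ⟨y, hy, fun h0 => absurd h0 hn⟩
  choose g hg hg₀ using h'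
  let y : φ.HomStar X A := DFinsupp.mk
    (DFinsupp.support (show ⨁ n : ℤ, φ.HomDeg X B n from x)) fun n => g n
  have hy : ∀ n, φ.component X A n y = g n := by
    intro n
    change (if _ then g n else 0) = g n
    split_ifs with hn
    · rfl
    · exact (hg₀ n (DFinsupp.notMem_support_iff.1 hn)).symm
  refine ⟨y, fun n hn => ?_, φ.homStar_ext fun n => ?_⟩
  · rw [hy, hg₀ n (hx n hn)]
  · rw [φ.component_starMap X hu n n (zero_add n), hy, hg]

section Shift

variable (φ : CentralAction T 𝒜) (X Y : T) {d : ℕ}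

theorem isCentral_id_shift (h𝒜 : ∀ m, ¬ Even m → ∀ r : 𝒜 m, r = 0) (hd : 1 ≤ d) :
    φ.IsCentral (A := Y⟦(d : ℤ)⟧) (B := Y) (c := (d : ℤ)) (𝟙 _) :=
  φ.isCentral_of_even h𝒜 hd _

theorem homLength_shift (h𝒜 : ∀ m, ¬ Even m → ∀ r : 𝒜 m, r = 0) (hd : 1 ≤ d)
    (n k : ℤ) (h : (d : ℤ) + n = k) :
    φ.homLength X (Y⟦(d : ℤ)⟧) n = φ.homLength X Y k :=
  (LinearEquiv.ofBijective (φ.compLin X (φ.isCentral_id_shift Y h𝒜 hd) n k h)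
    (φ.compHom_id_bijective X Y d n k h)).length_eq

theorem starMap_id_shift_injective (h𝒜 : ∀ m, ¬ Even m → ∀ r : 𝒜 m, r = 0) (hd : 1 ≤ d) :
    Function.Injective (φ.starMap X (φ.isCentral_id_shift Y h𝒜 hd)) := by
  intro x y hxy
  refine φ.homStar_ext fun n => (φ.compHom_id_bijective X Y d n _ rfl).1 ?_
  rw [← φ.component_starMap X (φ.isCentral_id_shift Y h𝒜 hd),
    ← φ.component_starMap X (φ.isCentral_id_shift Y h𝒜 hd), hxy]

end Shift

end CentralAction

/-! ### `Hom^*(X, K)` for a Koszul object `K` -/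

namespace CentralAction

section KerLength

variable {T : Type u} [Category.{v} T] [HasShift T ℤ] [Preadditive T]
  [∀ n : ℤ, (shiftFunctor T n).Additive]
  {R : Type w} [Ring R] {𝒜 : ℕ → AddSubgroup R} [GradedRing 𝒜]

/-- The length of the kernel of multiplication by `z` on `Hom(X, Σ^n Y)`. -/
noncomputable def kerLength (φ : CentralAction T 𝒜) (X Y : T) {d : ℕ} (z : 𝒜 d) (n : ℤ) : ℕ∞ :=
  Module.length (𝒜 0)
    (LinearMap.ker (φ.compLin X (φ.isCentral_mk₀ (φ.app z Y)) n n (zero_add n)))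

theorem kerLength_le (φ : CentralAction T 𝒜) (X Y : T) {d : ℕ} (z : 𝒜 d) (n : ℤ) :
    φ.kerLength X Y z n ≤ φ.homLength X Y n :=
  Module.length_le_of_injective (Submodule.subtype _) (Submodule.subtype_injective _)

theorem EventuallyInjective.kerLength_eq_zero {φ : CentralAction T 𝒜} {X Y : T} {d : ℕ} {z : 𝒜 d}
    (hz : φ.EventuallyInjective X Y z) : ∀ᶠ n : ℤ in atTop, φ.kerLength X Y z n = 0 := by
  filter_upwards [hz] with n hn
  refine Module.length_eq_zero_iff.2 ((Submodule.subsingleton_iff_eq_bot).2 ?_)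
  refine (Submodule.eq_bot_iff _).2 fun x hx => ?_
  exact (map_eq_zero_iff _ hn).1 ((φ.act_eq_zero_iff_comp_shift X Y z n _ rfl x).2 hx)

theorem EventuallyInjective.homLength_eq_zero {φ : CentralAction T 𝒜} {X Y : T} {d : ℕ} {z : 𝒜 d}
    (hz : φ.EventuallyInjective X Y z)
    (h : (z : R) ∈ φ.eventualAnnihilator X Y) : ∀ᶠ n : ℤ in atTop, φ.homLength X Y n = 0 := by
  obtain ⟨n₀, hn₀⟩ := h
  filter_upwards [hz, eventually_ge_atTop n₀] with n hn hn'
  refine Module.length_eq_zero_iff.2 (subsingleton_of_forall_eq 0 fun x => ?_)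
  refine (map_eq_zero_iff _ hn).1 ?_
  have h₁ := hn₀ (φ.single X Y n x) fun i hi => φ.component_single_of_ne X Y (by omega) x
  rw [φ.smul_single X Y d z n _ rfl] at h₁
  rw [← φ.component_single_same X Y _ (φ.act X Y d n (d + n) rfl z x), h₁, map_zero]

end KerLength

variable {T : Type u} [Category.{v} T] [HasZeroObject T] [HasShift T ℤ] [Preadditive T]
  [∀ n : ℤ, (shiftFunctor T n).Additive] [Pretriangulated T]
  {R : Type w} [Ring R] {𝒜 : ℕ → AddSubgroup R} [GradedRing 𝒜]
  {φ : CentralAction T 𝒜} {X Y K : T} {d : ℕ} {z : 𝒜 d}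

namespace IsKoszulObject

theorem homLength_add (hK : φ.IsKoszulObject z Y K) (h𝒜 : ∀ m, ¬ Even m → ∀ r : 𝒜 m, r = 0)
    (hd : 1 ≤ d) (n : ℤ) :
    φ.homLength X K n + φ.homLength X Y n =
      φ.homLength X Y (n + d) + (φ.kerLength X Y z n + φ.kerLength X Y z (n + 1)) := by
  obtain ⟨f, g, hT⟩ := hK
  rw [← φ.homLength_shift X Y h𝒜 hd n (n + d) (by omega)]
  refine Module.length_add_length_of_exact (A := 𝒜 0)
    (α := φ.compLin X (φ.isCentral_mk₀ (φ.app z Y)) n n (zero_add n))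
    (β := φ.compLin X (φ.isCentral_mk₀ f) n n (zero_add n))
    (γ := φ.compLin X (φ.isCentral_of_even (A := K) (B := Y) h𝒜 (c := 1) le_rfl g) n (n + 1)
      (add_comm _ _))
    (δ := φ.compLin X (φ.isCentral_mk₀ (φ.app z Y)) (n + 1) (n + 1) (zero_add _))
    (koszul_exact₂ hT n) (koszul_exact₃ hT n (n + 1) (add_comm _ _)) fun x => ?_
  exact (φ.act_eq_zero_iff_comp_shift X Y z (n + 1) _ rfl x).symm.trans
    (koszul_exact₁ hT n (n + 1) _ (add_comm _ _) rfl x)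

/-- Exactness at `Hom(X, Σ^n K)` alone. It supplies finiteness in every degree and vanishing for `n
≪ 0`. -/
theorem homLength_le (hK : φ.IsKoszulObject z Y K) (h𝒜 : ∀ m, ¬ Even m → ∀ r : 𝒜 m, r = 0)
    (hd : 1 ≤ d) (n : ℤ) :
    φ.homLength X K n ≤ φ.homLength X Y (n + d) + φ.homLength X Y (n + 1) := by
  obtain ⟨f, g, hT⟩ := hK
  rw [← φ.homLength_shift X Y h𝒜 hd n (n + d) (by omega)]
  exact Module.length_le_add_of_exact (A := 𝒜 0)
    (β := φ.compLin X (φ.isCentral_mk₀ f) n n (zero_add n))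
    (γ := φ.compLin X (φ.isCentral_of_even (A := K) (B := Y) h𝒜 (c := 1) le_rfl g) n (n + 1)
      (add_comm _ _))
    (koszul_exact₃ hT n (n + 1) (add_comm _ _))

theorem vanishesBelow (hK : φ.IsKoszulObject z Y K) (h𝒜 : ∀ m, ¬ Even m → ∀ r : 𝒜 m, r = 0)
    (hd : 1 ≤ d) (h : φ.VanishesBelow X Y) : φ.VanishesBelow X K := by
  filter_upwards [(tendsto_atBot_add_const_right atBot (d : ℤ) tendsto_id).eventually h,
    (tendsto_atBot_add_const_right atBot (1 : ℤ) tendsto_id).eventually h] with n h₁ h₂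
  have := hK.homLength_le (X := X) h𝒜 hd n
  simp only [id_eq] at h₁ h₂
  rwa [h₁, h₂, add_zero, nonpos_iff_eq_zero] at this

/-- Subtraction in `homLength_add` is legitimate because all lengths are finite. The kernel terms
die in large degrees but are needed for the Euler characteristic, which sees all degrees. -/
theorem lam_eq (hK : φ.IsKoszulObject z Y K) (h𝒜 : ∀ m, ¬ Even m → ∀ r : 𝒜 m, r = 0)
    (hd : 1 ≤ d) (h : ∀ n, φ.homLength X Y n < ⊤) (n : ℤ) :
    φ.lam X K n = φ.lam X Y (n + d) - φ.lam X Y n +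
      ((φ.kerLength X Y z n).toNat + (φ.kerLength X Y z (n + 1)).toNat) := by
  have h₁ := hK.homLength_add (X := X) h𝒜 hd n
  have hY := fun n => (h n).ne
  have hk := fun n => ((φ.kerLength_le X Y z n).trans_lt (h n)).ne
  have hKn := ((hK.homLength_le (X := X) h𝒜 hd n).trans_lt
    (ENat.add_lt_top.2 ⟨h _, h _⟩)).ne
  have h₂ := congrArg ENat.toNat h₁
  rw [ENat.toNat_add hKn (hY n), ENat.toNat_add (hY _) (ENat.add_lt_top.2
    ⟨(hk n).lt_top, (hk (n + 1)).lt_top⟩).ne, ENat.toNat_add (hk n) (hk (n + 1))] at h₂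
  simp only [lam]
  omega

/-- If `z` is eventually injective, then `Hom^*(X, Σ^d Y) ⟶ Hom^*(X, K)` is eventually
surjective. -/
theorem exists_surjective {f : Y⟦(d : ℤ)⟧ ⟶ K} {g : K ⟶ Y⟦(1 : ℤ)⟧}
    (hT : Triangle.mk (φ.app z Y) f g ∈ distTriang T) (hz : φ.EventuallyInjective X Y z) :
    ∃ n₁ : ℤ, ∀ n ≥ n₁,
      Function.Surjective (φ.compHom X (ShiftedHom.mk₀ (0 : ℤ) rfl f) n n (zero_add n)) := by
  obtain ⟨n₁, hn₁⟩ := eventually_atTop.1 hz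
  refine ⟨n₁, fun n hn x => ?_⟩
  refine (koszul_exact₃ hT n (1 + n) rfl x).1 ((map_eq_zero_iff _ (hn₁ (1 + n) (by omega))).1 ?_)
  exact (koszul_exact₁ hT n (1 + n) _ rfl rfl _).2 ⟨x, rfl⟩

/-- `z` annihilates the image of `Hom^*(X, Σ^d Y)` in `Hom^*(X, K)`. -/
theorem act_compHom_eq_zero {f : Y⟦(d : ℤ)⟧ ⟶ K} {g : K ⟶ Y⟦(1 : ℤ)⟧}
    (hT : Triangle.mk (φ.app z Y) f g ∈ distTriang T) (h𝒜 : ∀ m, ¬ Even m → ∀ r : 𝒜 m, r = 0)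
    (hd : 1 ≤ d) (n k : ℤ) (h : (d : ℤ) + n = k) (y : φ.HomDeg X (Y⟦(d : ℤ)⟧) n) :
    φ.act X K d n k h z (φ.compHom X (ShiftedHom.mk₀ (0 : ℤ) rfl f) n n (zero_add n) y) = 0 := by
  rw [φ.act_compHom X (φ.isCentral_mk₀ f) d z n n k k _ h h (zero_add k)]
  refine (koszul_exact₂ hT k _).2
    ⟨φ.compHom X (A := Y⟦(d : ℤ)⟧) (B := Y) (c := d) (𝟙 _) n k h y, ?_⟩
  -- After this injection both sides become `z` acting on `y`, viewed in `Hom(X, Σ^k Y)`, by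
  -- centrality of the identification.
  refine (φ.compHom_id_bijective X Y d k _ rfl).1 ?_
  rw [φ.compHom_id_compHom_mk₀ X Y d (φ.app z Y) k _ rfl, ← act_apply,
    φ.act_compHom X (φ.isCentral_id_shift Y h𝒜 hd) d z n k k _ h rfl h rfl]

/-- In large degrees `Hom^*(X, K)` is a quotient of `Hom^*(X, Σ^d Y)`, which embeds `R`-linearly in
a Noetherian truncation of `Hom^*(X, Y)`. -/
theorem noethFL (hK : φ.IsKoszulObject z Y K) (h𝒜 : ∀ m, ¬ Even m → ∀ r : 𝒜 m, r = 0)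
    (hd : 1 ≤ d) (hz : φ.EventuallyInjective X Y z) (h : φ.NoethFL X Y) : φ.NoethFL X K := by
  refine ⟨?_, fun n => (hK.homLength_le h𝒜 hd n).trans_lt
    (ENat.add_lt_top.2 ⟨h.length_lt_top _, h.length_lt_top _⟩)⟩
  obtain ⟨f, g, hT⟩ := hK
  obtain ⟨n₀, hn₀⟩ := h.noetherian
  obtain ⟨n₁, hn₁⟩ := exists_surjective hT hz
  refine ⟨max n₀ n₁, ?_⟩
  have hι : ∀ x ∈ φ.homGE X (Y⟦(d : ℤ)⟧) (max n₀ n₁),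
      φ.starMap X (φ.isCentral_id_shift Y h𝒜 hd) x ∈ φ.homGE X Y n₀ := fun x hx n hn =>
    φ.starMap_mem_homGE X (φ.isCentral_id_shift Y h𝒜 hd) hx n (by omega)
  have hN : IsNoetherian R (φ.homGE X (Y⟦(d : ℤ)⟧) (max n₀ n₁)) :=
    isNoetherian_of_injective ((φ.starMap X (φ.isCentral_id_shift Y h𝒜 hd)).restrict hι)
      fun x y hxy => Subtype.ext
        (φ.starMap_id_shift_injective X Y h𝒜 hd (congrArg Subtype.val hxy))
  have hf : ∀ x ∈ φ.homGE X (Y⟦(d : ℤ)⟧) (max n₀ n₁),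
      φ.starMap X (φ.isCentral_mk₀ f) x ∈ φ.homGE X K (max n₀ n₁) := fun x hx n hn =>
    φ.starMap_mem_homGE X (φ.isCentral_mk₀ f) hx n (by omega)
  refine isNoetherian_of_surjective ((φ.starMap X (φ.isCentral_mk₀ f)).restrict hf)
    (LinearMap.range_eq_top.2 ?_)
  rintro ⟨x, hx⟩
  obtain ⟨y, hy, rfl⟩ := φ.exists_starMap_eq X (φ.isCentral_mk₀ f) (max n₀ n₁)
    (fun n hn => hn₁ n ((le_max_right _ _).trans hn)) x hx
  exact ⟨⟨y, hy⟩, rfl⟩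

theorem eventualAnnihilator_le (hK : φ.IsKoszulObject z Y K)
    (h𝒜 : ∀ m, ¬ Even m → ∀ r : 𝒜 m, r = 0) (hd : 1 ≤ d) (hz : φ.EventuallyInjective X Y z) :
    φ.eventualAnnihilator X Y ≤ φ.eventualAnnihilator X K := by
  rintro r ⟨n₀, hn₀⟩
  obtain ⟨f, g, hT⟩ := hK
  obtain ⟨n₁, hn₁⟩ := exists_surjective hT hz
  refine ⟨max n₀ n₁, fun x hx => ?_⟩
  obtain ⟨y, hy, rfl⟩ := φ.exists_starMap_eq X (φ.isCentral_mk₀ f) (max n₀ n₁)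
    (fun n hn => hn₁ n ((le_max_right _ _).trans hn)) x hx
  have hry : r • y = 0 := by
    refine φ.starMap_id_shift_injective X Y h𝒜 hd ?_
    rw [map_smul, map_zero]
    exact hn₀ _ fun n hn =>
      φ.starMap_mem_homGE X (φ.isCentral_id_shift Y h𝒜 hd) hy n (by omega)
  rw [← map_smul, hry, map_zero]

theorem mem_eventualAnnihilator (hK : φ.IsKoszulObject z Y K)
    (h𝒜 : ∀ m, ¬ Even m → ∀ r : 𝒜 m, r = 0) (hd : 1 ≤ d) (hz : φ.EventuallyInjective X Y z) :
    (z : R) ∈ φ.eventualAnnihilator X K := by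
  obtain ⟨f, g, hT⟩ := hK
  obtain ⟨n₁, hn₁⟩ := exists_surjective hT hz
  refine ⟨n₁, fun x hx => φ.homStar_ext fun k => ?_⟩
  rw [φ.component_smul X K d z (k - d) k (by omega), map_zero]
  by_cases hk : k - d < n₁
  · rw [hx _ hk, map_zero]
  · obtain ⟨y, hy⟩ := hn₁ _ (not_lt.1 hk) (φ.component X K (k - d) x)
    rw [← hy, act_compHom_eq_zero hT h𝒜 hd]

end IsKoszulObject

theorem exists_isKoszulObject (φ : CentralAction T 𝒜) (z : 𝒜 d) (Y : T) :
    ∃ K : T, φ.IsKoszulObject z Y K := by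
  obtain ⟨K, f, g, h⟩ := distinguished_cocone_triangle (φ.app z Y)
  exact ⟨K, f, g, h⟩

end CentralAction

/-! ### Differences of polynomials and of functions on the integers -/

namespace CentralAction

/-- The leading terms of `g(t + 1)` and `g(t)` cancel, and the next coefficient is `deg g` times the
leading one. For `g = 0` the truncated subtraction gives the right value `0`. -/
theorem degSucc_taylor_sub (g : ℚ[X]) : degSucc (Polynomial.taylor 1 g - g) = degSucc g - 1 := by
  rcases Nat.eq_zero_or_pos g.natDegree with h0 | hpos
  · rw [Polynomial.eq_C_of_natDegree_eq_zero h0]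
    simp only [Polynomial.taylor_C, sub_self, degSucc, if_true, Polynomial.natDegree_C]
    split_ifs <;> rfl
  · obtain ⟨n, hn⟩ : ∃ n, g.natDegree = n + 1 := ⟨g.natDegree - 1, by omega⟩
    have hg : g ≠ 0 := by rintro rfl; simp at hpos
    have hcoeff : (Polynomial.taylor 1 g - g).coeff n = (n + 1) * g.leadingCoeff := by
      rw [Polynomial.coeff_sub, Polynomial.taylor_coeff, Polynomial.eval_eq_sum_range'
        (n := 2) (lt_of_le_of_lt (Polynomial.natDegree_hasseDeriv_le g n) (by omega))]
      simp only [Finset.sum_range_succ, Finset.sum_range_zero, Polynomial.hasseDeriv_coeff,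
        Polynomial.leadingCoeff, hn]
      simp [add_comm 1 n]
    have hne : (Polynomial.taylor 1 g - g).coeff n ≠ 0 := by
      rw [hcoeff]
      exact mul_ne_zero (by positivity) (Polynomial.leadingCoeff_ne_zero.2 hg)
    have hlt : (Polynomial.taylor 1 g - g).degree < (n + 1 : ℕ) := by
      rw [← hn, ← Polynomial.degree_eq_natDegree hg, ← Polynomial.degree_taylor g 1]
      refine Polynomial.degree_sub_lt_left (Polynomial.degree_taylor g 1) ?_ ?_
      · rwa [Ne, Polynomial.taylor_eq_zero]
      · exact Polynomial.leadingCoeff_taylor ..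
    have hle := Polynomial.le_natDegree_of_ne_zero hne
    have hne' : Polynomial.taylor 1 g - g ≠ 0 := by
      intro h; rw [h] at hne; simp at hne
    have := (Polynomial.natDegree_lt_iff_degree_lt hne').2 hlt
    rw [degSucc, degSucc, if_neg hne', if_neg hg]
    omega

/-- Bernoulli polynomials satisfy `B_(n+1)(x + 1) - B_(n+1)(x) = (n + 1) x^n`, so they sum
monomials. -/
theorem exists_eval_add_one_sub (p : ℚ[X]) :
    ∃ q : ℚ[X], ∀ x : ℚ, q.eval (x + 1) - q.eval x = p.eval x := by
  induction p using Polynomial.induction_on' with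
  | add p q hp hq =>
    obtain ⟨p', hp⟩ := hp
    obtain ⟨q', hq⟩ := hq
    refine ⟨p' + q', fun x => ?_⟩
    rw [Polynomial.eval_add, Polynomial.eval_add, Polynomial.eval_add, ← hp, ← hq]
    ring
  | monomial n a =>
    refine ⟨Polynomial.C (a / (n + 1)) * Polynomial.bernoulli (n + 1), fun x => ?_⟩
    have h : (n + 1 : ℚ) ≠ 0 := by positivity
    simp only [Polynomial.eval_mul, add_comm x 1, Polynomial.bernoulli_eval_one_add,
      Polynomial.eval_C, Polynomial.eval_monomial, Nat.add_sub_cancel]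
    push_cast
    field_simp
    ring

/-- The polynomials `g_0, …, g_{d-1}` give the values of `f` on the residue classes modulo `d`, in
large degrees. -/
def IsEventuallyPolynomial (d : ℕ) (f : ℤ → ℤ) (g : ℕ → ℚ[X]) : Prop :=
  ∀ i < d, ∀ᶠ n : ℤ in atTop, (g i).eval (n : ℚ) = f (d * n + i)

/-- The alternating sum of `d` successive values of `f`. -/
def altSum (d : ℕ) (f : ℤ → ℤ) (n : ℤ) : ℤ :=
  ∑ i ∈ Finset.range d, ((n + i).negOnePow : ℤ) * f (n + i)

section Numeric

variable {d : ℕ} {f f' : ℤ → ℤ} {g g' : ℕ → ℚ[X]}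

theorem tendsto_mul_add_atTop (hd : 1 ≤ d) (i : ℤ) :
    Tendsto (fun n : ℤ => (d : ℤ) * n + i) atTop atTop :=
  tendsto_atTop_add_const_right _ _ (tendsto_id.const_mul_atTop' (by exact_mod_cast hd))

theorem IsEventuallyPolynomial.congr (h : IsEventuallyPolynomial d f g) (hd : 1 ≤ d)
    (hf : f =ᶠ[atTop] f') : IsEventuallyPolynomial d f' g := by
  intro i hi
  filter_upwards [h i hi, (tendsto_mul_add_atTop hd i).eventually hf] with n h₁ h₂
  rw [h₁, h₂]

theorem IsEventuallyPolynomial.unique (h : IsEventuallyPolynomial d f g)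
    (h' : IsEventuallyPolynomial d f g') {i : ℕ} (hi : i < d) : g i = g' i := by
  obtain ⟨N, hN⟩ := eventually_atTop.1 ((h i hi).and (h' i hi))
  refine Polynomial.eq_of_infinite_eval_eq _ _ (Set.Infinite.mono ?_
    ((Set.Ici_infinite N).image (f := fun n : ℤ => (n : ℚ)) Int.cast_injective.injOn))
  rintro _ ⟨n, hn, rfl⟩
  exact (hN n hn).1.trans (hN n hn).2.symm

theorem IsEventuallyPolynomial.diffOp (h : IsEventuallyPolynomial d f g) :
    IsEventuallyPolynomial d (diffOp d f) fun i => Polynomial.taylor 1 (g i) - g i := by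
  intro i hi
  filter_upwards [h i hi, (tendsto_atTop_add_const_right atTop (1 : ℤ) tendsto_id).eventually
    (h i hi)] with n h₁ h₂
  simp only [id_eq] at h₂
  rw [Polynomial.eval_sub, Polynomial.taylor_eval, h₁]
  push_cast at h₂
  rw [h₂, CentralAction.diffOp, show (d : ℤ) * (n + 1) + i = d * n + i + d by ring]
  push_cast
  rfl

theorem IsEventuallyPolynomial.exists_of_diffOp (h : IsEventuallyPolynomial d (CentralAction.diffOp d f) g) :
    ∃ g', IsEventuallyPolynomial d f g' := by
  suffices H : ∀ i < d, ∃ p : ℚ[X], ∀ᶠ n : ℤ in atTop, p.eval (n : ℚ) = f (d * n + i) by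
    choose! g' hg' using H
    exact ⟨g', hg'⟩
  intro i hi
  obtain ⟨N, hN⟩ := eventually_atTop.1 (h i hi)
  obtain ⟨q, hq⟩ := exists_eval_add_one_sub (g i)
  -- The constant makes the polynomial agree with `f` at `n = N`; equal differences do the rest.
  refine ⟨q + Polynomial.C (f (d * N + i) - q.eval (N : ℚ)), eventually_atTop.2 ⟨N, fun n hn => ?_⟩⟩
  rw [Polynomial.eval_add, Polynomial.eval_C]
  induction n, hn using Int.leInduction with
  | base => ring
  | succ n hn ih =>
    have h₁ := hN n hn
    rw [← hq, CentralAction.diffOp] at h₁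
    rw [show (d : ℤ) * (n + 1) + i = d * n + i + d by ring]
    push_cast at h₁ ⊢
    linarith

theorem eventually_of_forall_residue (hd : 1 ≤ d) {p : ℤ → Prop}
    (h : ∀ i < d, ∀ᶠ n : ℤ in atTop, p (d * n + i)) : ∀ᶠ n : ℤ in atTop, p n := by
  have h' : ∀ᶠ n : ℤ in atTop, ∀ i ∈ Finset.range d, p (d * n + i) :=
    (Finset.eventually_all _).2 fun i hi => h i (Finset.mem_range.1 hi)
  obtain ⟨N, hN⟩ := eventually_atTop.1 h'
  refine eventually_atTop.2 ⟨N * d, fun n hn => ?_⟩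
  have hd' : (0 : ℤ) < d := by exact_mod_cast hd
  have h₁ := hN (n / d) ((Int.le_ediv_iff_mul_le hd').2 hn) (n % d).toNat (Finset.mem_range.2 (by
    have := Int.emod_lt_of_pos n hd'
    omega))
  rwa [Int.toNat_of_nonneg (Int.emod_nonneg _ hd'.ne'), Int.mul_ediv_add_emod] at h₁

theorem IsEventuallyPolynomial.eventually_eq_zero (h : IsEventuallyPolynomial d f g) (hd : 1 ≤ d)
    (hg : ∀ i < d, degSucc (g i) = 0) : ∀ᶠ n : ℤ in atTop, f n = 0 := by
  refine eventually_of_forall_residue hd fun i hi => ?_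
  have hi0 : g i = 0 := by
    have := hg i hi
    by_contra hne
    simp [degSucc, hne] at this
  filter_upwards [h i hi] with n hn
  rw [hi0, Polynomial.eval_zero] at hn
  exact_mod_cast hn.symm

theorem IsEventuallyPolynomial.iterate_diffOp_eq_zero (h : IsEventuallyPolynomial d f g)
    (hd : 1 ≤ d) {s : ℕ} (hg : ∀ i < d, degSucc (g i) ≤ s) :
    ∀ᶠ n : ℤ in atTop, (CentralAction.diffOp d)^[s] f n = 0 := by
  induction s generalizing f g with
  | zero => exact h.eventually_eq_zero hd fun i hi => Nat.le_zero.1 (hg i hi)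
  | succ s ih =>
    refine ih h.diffOp fun i hi => ?_
    have := hg i hi
    rw [degSucc_taylor_sub]
    omega

theorem diffOp_iterate_congr (hf : f =ᶠ[atTop] f') (s : ℕ) :
    (diffOp d)^[s] f =ᶠ[atTop] (diffOp d)^[s] f' := by
  induction s generalizing f f' with
  | zero => exact hf
  | succ s ih =>
    refine ih ?_
    filter_upwards [hf, (tendsto_atTop_add_const_right atTop (d : ℤ) tendsto_id).eventually hf]
      with n h₁ h₂
    simp only [id_eq] at h₂
    rw [diffOp, diffOp, h₁, h₂]

theorem altSum_congr (hf : f =ᶠ[atTop] f') : altSum d f =ᶠ[atTop] altSum d f' := by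
  obtain ⟨N, hN⟩ := eventually_atTop.1 hf
  filter_upwards [eventually_ge_atTop N] with n hn
  exact Finset.sum_congr rfl fun i _ => by rw [hN _ (by omega)]

theorem diffOp_altSum (hd : Even d) (f : ℤ → ℤ) :
    diffOp d (altSum d f) = altSum d (diffOp d f) := by
  funext n
  simp only [diffOp, altSum, mul_sub, Finset.sum_sub_distrib]
  congr 1
  refine Finset.sum_congr rfl fun i _ => ?_
  rw [add_right_comm n d i, Int.negOnePow_add, Int.negOnePow_even (d : ℤ) (by exact_mod_cast hd),
    mul_one]

theorem diffOp_iterate_altSum (hd : Even d) (f : ℤ → ℤ) (s : ℕ) :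
    (diffOp d)^[s] (altSum d f) = altSum d ((diffOp d)^[s] f) := by
  induction s generalizing f with
  | zero => rfl
  | succ s ih => rw [Function.iterate_succ_apply, diffOp_altSum hd, ih, Function.iterate_succ_apply]

/-- Adjacent windows share all but their extreme terms, and these carry the same sign as `d` is
even. -/
theorem altSum_add_one_sub (hd : Even d) (f : ℤ → ℤ) (n : ℤ) :
    altSum d f (n + 1) - altSum d f n = (n.negOnePow : ℤ) * diffOp d f n := by
  have h₁ := Finset.sum_range_succ' (fun i : ℕ => ((n + i).negOnePow : ℤ) * f (n + i)) d
  rw [Finset.sum_range_succ] at h₁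
  have h₂ : altSum d f (n + 1) = ∑ i ∈ Finset.range d,
      ((n + (i + 1 : ℕ)).negOnePow : ℤ) * f (n + (i + 1 : ℕ)) :=
    Finset.sum_congr rfl fun i _ => by
      rw [show n + 1 + (i : ℤ) = n + (i + 1 : ℕ) by push_cast; ring]
  rw [Int.negOnePow_add, Int.negOnePow_even (d : ℤ) (by exact_mod_cast hd), mul_one,
    Nat.cast_zero, add_zero] at h₁
  rw [h₂, altSum, diffOp, mul_sub]
  linarith

theorem exists_eventually_eq_of_add_one_eq (h : ∀ᶠ n : ℤ in atTop, f (n + 1) - f n = 0) :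
    ∃ e, ∀ᶠ n : ℤ in atTop, f n = e := by
  obtain ⟨N, hN⟩ := eventually_atTop.1 h
  refine ⟨f N, eventually_atTop.2 ⟨N, fun n hn => ?_⟩⟩
  induction n, hn using Int.leInduction with
  | base => rfl
  | succ n hn ih => rw [← ih, sub_eq_zero.1 (hN n hn)]

/-- By `altSum_add_one_sub`, the step from `n` to `n + 1` is `± Δ^(s+1) f(n)`. Hence the values are
constant, not merely periodic modulo `d`. -/
theorem exists_iterate_diffOp_altSum_eq (hd : Even d) (s : ℕ)
    (h : ∀ᶠ n : ℤ in atTop, (diffOp d)^[s + 1] f n = 0) :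
    ∃ e, ∀ᶠ n : ℤ in atTop, (diffOp d)^[s] (altSum d f) n = e := by
  refine exists_eventually_eq_of_add_one_eq ?_
  filter_upwards [h] with n hn
  rw [Function.iterate_succ_apply'] at hn
  rw [diffOp_iterate_altSum hd, altSum_add_one_sub hd, hn, mul_zero]

theorem finsum_add_one_sub {e : ℤ} (h₁ : ∀ᶠ n : ℤ in atBot, f n = 0)
    (h₂ : ∀ᶠ n : ℤ in atTop, f n = e) : ∑ᶠ n : ℤ, (f (n + 1) - f n) = e := by
  obtain ⟨a, ha⟩ := eventually_atBot.1 h₁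
  obtain ⟨b, hb⟩ := eventually_atTop.1 h₂
  have hsum : ∀ n, a ≤ n → ∑ i ∈ Finset.Ico a n, (f (i + 1) - f i) = f n - f a := by
    intro n hn
    induction n, hn using Int.leInduction with
    | base => simp
    | succ n hn ih =>
      rw [← Finset.insert_Ico_right_eq_Ico_add_one hn, Finset.sum_insert (by simp), ih]
      ring
  rw [finsum_eq_sum_of_support_subset (s := Finset.Ico a (max a b)), hsum _ (le_max_left _ _),
    hb _ (le_max_right _ _), ha a le_rfl, sub_zero]
  intro n hn
  by_contra hmem
  simp only [Finset.coe_Ico, Set.mem_Ico, not_and_or, not_le, not_lt] at hmem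
  refine hn ?_
  obtain hlt | hge := hmem
  · dsimp only
    rw [ha n hlt.le, ha (n + 1) hlt, sub_zero]
  · dsimp only
    rw [hb n (le_trans (le_max_right _ _) hge),
      hb (n + 1) (le_trans (le_trans (le_max_right _ _) hge) (by omega)), sub_self]

theorem finite_of_eventually_eq_zero (h₁ : ∀ᶠ n : ℤ in atBot, f n = 0)
    (h₂ : ∀ᶠ n : ℤ in atTop, f n = 0) : {n | f n ≠ 0}.Finite := by
  obtain ⟨a, ha⟩ := eventually_atBot.1 h₁
  obtain ⟨b, hb⟩ := eventually_atTop.1 h₂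
  refine (Set.finite_Icc a b).subset fun n hn => ⟨?_, ?_⟩
  · exact le_of_not_gt fun h => hn (ha n h.le)
  · exact le_of_not_gt fun h => hn (hb n h.le)

/-- The Euler characteristic of `f'`, when `f'` differs from `Δ f` by a telescoping term. -/
theorem finsum_negOnePow_mul_eq (hd : Even d) {κ : ℤ → ℤ} {e : ℤ}
    (h : ∀ n, f' n = f (n + d) - f n + (κ n + κ (n + 1)))
    (hf : ∀ᶠ n : ℤ in atBot, f n = 0) (hκ : ∀ᶠ n : ℤ in atBot, κ n = 0)
    (hκ' : ∀ᶠ n : ℤ in atTop, κ n = 0) (he : ∀ᶠ n : ℤ in atTop, altSum d f n = e) :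
    ∑ᶠ n : ℤ, (n.negOnePow : ℤ) * f' n = e := by
  -- Since `(-1)^(n+1) = -(-1)^n`, subtracting `(-1)^n κ n` turns `κ n + κ (n + 1)` into a
  -- successive difference, so the whole summand telescopes.
  refine Eq.trans ?_ (finsum_add_one_sub (f := fun n => altSum d f n - (n.negOnePow : ℤ) * κ n)
    (e := e) ?_ ?_)
  · refine finsum_congr fun n => ?_
    have := altSum_add_one_sub hd f n
    rw [diffOp] at this
    rw [h, Int.negOnePow_succ]
    push_cast
    linear_combination -this
  · obtain ⟨a, ha⟩ := eventually_atBot.1 hf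
    filter_upwards [hκ, eventually_le_atBot (a - d)] with n h₁ h₂
    rw [h₁, mul_zero, sub_zero]
    refine Finset.sum_eq_zero fun i hi => ?_
    have := Finset.mem_range.1 hi
    rw [ha _ (by omega), mul_zero]
  · filter_upwards [hκ', he] with n h₁ h₂
    rw [h₁, h₂, mul_zero, sub_zero]

end Numeric

end CentralAction

/-! ### Complexity and multiplicity -/

namespace CentralAction

section Complexity

variable {T : Type u} [Category.{v} T] [HasShift T ℤ] [Preadditive T]
  [∀ n : ℤ, (shiftFunctor T n).Additive]
  {R : Type w} [Ring R] {𝒜 : ℕ → AddSubgroup R} [GradedRing 𝒜]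
  {φ : CentralAction T 𝒜} {d : ℕ} {X Y : T}

theorem HasComplexity.cx_eq {c : ℕ} (h : φ.HasComplexity d X Y c) : φ.cx d X Y = c := by
  have hex : ∃ c, φ.HasComplexity d X Y c := ⟨c, h⟩
  rw [cx, dif_pos hex]
  obtain ⟨g, hg, hc⟩ := hex.choose_spec
  obtain ⟨g', hg', hc'⟩ := h
  rw [hc, hc']
  refine Finset.sup_congr rfl fun i hi => ?_
  rw [IsEventuallyPolynomial.unique (f := φ.lam X Y) hg hg' (Finset.mem_range.1 hi)]

theorem HasComplexity.hasComplexity_cx {c : ℕ} (h : φ.HasComplexity d X Y c) :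
    φ.HasComplexity d X Y (φ.cx d X Y) := by
  rwa [h.cx_eq]

theorem IsMultiplicity.unique {s : ℕ} {e e' : ℤ} (h : φ.IsMultiplicity d X Y s e)
    (h' : φ.IsMultiplicity d X Y s e') : e = e' := by
  obtain ⟨-, -, ⟨h₁, h₂⟩ | ⟨h₁, -, -, -, h₂⟩⟩ := h <;>
    obtain ⟨-, -, ⟨h₁', h₂'⟩ | ⟨h₁', -, -, -, h₂'⟩⟩ := h'
  · obtain ⟨n, hn, hn'⟩ := (h₂.and h₂').exists
    exact hn.symm.trans hn'
  · omega
  · omega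
  · rw [h₂, h₂']

theorem IsMultiplicity.multiplicity_eq {s : ℕ} {e : ℤ} (h : φ.IsMultiplicity d X Y s e) :
    φ.multiplicity d X Y s = e := by
  have hex : ∃ e, φ.IsMultiplicity d X Y s e := ⟨e, h⟩
  rw [multiplicity, dif_pos hex]
  exact hex.choose_spec.unique h

theorem HasComplexity.iterate_diffOp_eq_zero {c s : ℕ} (hc : φ.HasComplexity d X Y c)
    (hd : 1 ≤ d) (hcs : c ≤ s) : ∀ᶠ n : ℤ in atTop, (diffOp d)^[s] (φ.lam X Y) n = 0 := by
  obtain ⟨g, hg, rfl⟩ := hc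
  exact IsEventuallyPolynomial.iterate_diffOp_eq_zero (f := φ.lam X Y) hg hd fun i hi =>
    (Finset.le_sup (f := fun i => degSucc (g i)) (Finset.mem_range.2 hi)).trans hcs

theorem HasComplexity.exists_isMultiplicity (hc : φ.HasComplexity d X Y (φ.cx d X Y))
    (hd : 1 ≤ d) (hd₂ : Even d) (h₁ : 1 ≤ φ.cx d X Y) {s : ℕ} (hs : φ.cx d X Y ≤ s) :
    ∃ e, φ.IsMultiplicity d X Y s e ∧
      ∀ᶠ n : ℤ in atTop, (diffOp d)^[s - 1] (altSum d (φ.lam X Y)) n = e := by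
  obtain ⟨e, he⟩ := exists_iterate_diffOp_altSum_eq hd₂ (s - 1) (f := φ.lam X Y)
    (hc.iterate_diffOp_eq_zero hd (by omega))
  exact ⟨e, ⟨hc, hs, Or.inl ⟨h₁, he⟩⟩, he⟩

end Complexity

variable {T : Type u} [Category.{v} T] [HasZeroObject T] [HasShift T ℤ] [Preadditive T]
  [∀ n : ℤ, (shiftFunctor T n).Additive] [Pretriangulated T]
  {R : Type w}

section Ring

variable [Ring R] {𝒜 : ℕ → AddSubgroup R} [GradedRing 𝒜]
  {φ : CentralAction T 𝒜} {X Y K : T} {d : ℕ} {z : 𝒜 d}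

theorem IsKoszulObject.lam_eventuallyEq (hK : φ.IsKoszulObject z Y K)
    (h𝒜 : ∀ m, ¬ Even m → ∀ r : 𝒜 m, r = 0) (hd : 1 ≤ d) (hz : φ.EventuallyInjective X Y z)
    (h : ∀ n, φ.homLength X Y n < ⊤) : φ.lam X K =ᶠ[atTop] diffOp d (φ.lam X Y) := by
  have hk := hz.kerLength_eq_zero
  filter_upwards [hk, (tendsto_atTop_add_const_right atTop (1 : ℤ) tendsto_id).eventually hk]
    with n h₁ h₂
  simp only [id_eq] at h₂
  rw [hK.lam_eq h𝒜 hd h, h₁, h₂, diffOp]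
  simp

theorem IsKoszulObject.hasComplexity (hK : φ.IsKoszulObject z Y K)
    (h𝒜 : ∀ m, ¬ Even m → ∀ r : 𝒜 m, r = 0) (hd : 1 ≤ d) (hz : φ.EventuallyInjective X Y z)
    (h : ∀ n, φ.homLength X Y n < ⊤) {c : ℕ} (hc : φ.HasComplexity d X Y c) :
    φ.HasComplexity d X K (c - 1) := by
  obtain ⟨g, hg, rfl⟩ := hc
  refine ⟨_, (IsEventuallyPolynomial.diffOp (f := φ.lam X Y) hg).congr hd
    (hK.lam_eventuallyEq h𝒜 hd hz h).symm, ?_⟩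
  simp only [degSucc_taylor_sub]
  -- Truncated subtraction of one preserves maxima and the bottom element `0`.
  exact Finset.apply_sup_eq_sup_comp (fun n : ℕ => n - 1)
    (fun a b => by
      simp only [max_def]
      split_ifs <;> omega) rfl

/-- Complexity at least `2` for `Y` leaves at least `1` for `K`, so both multiplicities are limits
of differences of `h`, and `Δ` commutes with `altSum`. -/
theorem IsKoszulObject.isMultiplicity_pred (hK : φ.IsKoszulObject z Y K)
    (h𝒜 : ∀ m, ¬ Even m → ∀ r : 𝒜 m, r = 0) (hd : 1 ≤ d) (hd₂ : Even d)
    (hz : φ.EventuallyInjective X Y z) (h : ∀ n, φ.homLength X Y n < ⊤)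
    (hc : φ.HasComplexity d X Y (φ.cx d X Y)) (h₂ : 2 ≤ φ.cx d X Y) {s : ℕ}
    (hs : φ.cx d X Y ≤ s) {e : ℤ}
    (he : ∀ᶠ n : ℤ in atTop, (diffOp d)^[s - 1] (altSum d (φ.lam X Y)) n = e) :
    φ.IsMultiplicity d X K (s - 1) e := by
  have hcK := hK.hasComplexity h𝒜 hd hz h hc
  refine ⟨hcK.hasComplexity_cx, by rw [hcK.cx_eq]; omega, Or.inl ⟨by rw [hcK.cx_eq]; omega, ?_⟩⟩
  filter_upwards [he, diffOp_iterate_congr (d := d)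
    (altSum_congr (d := d) (hK.lam_eventuallyEq h𝒜 hd hz h)) (s - 1 - 1)] with n h₃ h₄
  refine Eq.trans h₄ (Eq.trans ?_ h₃)
  rw [← diffOp_altSum hd₂, ← Function.iterate_succ_apply,
    show (s - 1 - 1).succ = s - 1 by omega]

theorem IsKoszulObject.isMultiplicity_zero (hK : φ.IsKoszulObject z Y K)
    (h𝒜 : ∀ m, ¬ Even m → ∀ r : 𝒜 m, r = 0) (hd : 1 ≤ d) (hd₂ : Even d)
    (hz : φ.EventuallyInjective X Y z) (h : ∀ n, φ.homLength X Y n < ⊤)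
    (hc : φ.HasComplexity d X Y (φ.cx d X Y)) (h₁ : φ.cx d X Y = 1) (hY : φ.VanishesBelow X Y)
    {e : ℤ} (he : ∀ᶠ n : ℤ in atTop, altSum d (φ.lam X Y) n = e) :
    φ.IsMultiplicity d X K 0 e := by
  have hcK := hK.hasComplexity h𝒜 hd hz h hc
  have hcx : φ.cx d X K = 0 := by rw [hcK.cx_eq, h₁]
  have hKbelow := hK.vanishesBelow h𝒜 hd hY
  refine ⟨hcK.hasComplexity_cx, hcx.le, Or.inr ⟨hcx, rfl, hKbelow, ?_, ?_⟩⟩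
  · refine finite_of_eventually_eq_zero ?_
      -- Complexity `0` means that `Δ^0 λ`, which is `λ` itself, vanishes in large degrees.
      (hcK.iterate_diffOp_eq_zero hd (s := 0) (by rw [h₁]))
    filter_upwards [hKbelow] with n hn
    simp [lam, hn]
  · refine (finsum_negOnePow_mul_eq hd₂ (f := φ.lam X Y)
      (κ := fun n => ((φ.kerLength X Y z n).toNat : ℤ)) (hK.lam_eq h𝒜 hd h) ?_ ?_ ?_ he).symm
    · filter_upwards [hY] with n hn
      simp [lam, hn]
    · filter_upwards [hY] with n hn
      have := φ.kerLength_le X Y z n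
      rw [hn, nonpos_iff_eq_zero] at this
      simp [this]
    · filter_upwards [hz.kerLength_eq_zero] with n hn
      simp [hn]

end Ring

/-- Hilbert polynomials exist, by Noetherian induction on the eventual annihilator. -/
theorem exists_isEventuallyPolynomial [CommRing R] [IsNoetherianRing R] {𝒜 : ℕ → AddSubgroup R}
    [GradedRing 𝒜] (φ : CentralAction T 𝒜) (h𝒜 : ∀ m, ¬ Even m → ∀ r : 𝒜 m, r = 0) {d : ℕ}
    (hd : 1 ≤ d) (hgen : Subring.closure ((𝒜 0 : Set R) ∪ (𝒜 d : Set R)) = ⊤)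
    (hR₀ : ContainsInfiniteField (𝒜 0) ∨ IsLocalWithInfiniteResidueField (𝒜 0)) (X Y : T)
    (h : φ.NoethFL X Y) : ∃ g, IsEventuallyPolynomial d (φ.lam X Y) g := by
  generalize hJ : φ.eventualAnnihilator X Y = J
  induction J using WellFoundedGT.induction generalizing Y with
  | _ J ih =>
    subst hJ
    obtain ⟨z, hz⟩ := φ.exists_eventuallyInjective X Y hd hgen hR₀ h.noetherian
    -- If `z` is both eventually injective and eventually zero, the Hom groups vanish in large
    -- degrees. Otherwise the annihilator for `K` is strictly larger, as it contains `z`.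
    by_cases hzJ : (z : R) ∈ φ.eventualAnnihilator X Y
    · refine ⟨fun _ => 0, fun i _ => ?_⟩
      filter_upwards [(tendsto_mul_add_atTop hd (i : ℤ)).eventually (hz.homLength_eq_zero hzJ)]
        with n hn
      simp [lam, hn]
    · obtain ⟨K, hK⟩ := φ.exists_isKoszulObject z Y
      obtain ⟨g, hg⟩ := ih _ (lt_of_le_of_ne (hK.eventualAnnihilator_le h𝒜 hd hz) fun heq =>
        hzJ (heq ▸ hK.mem_eventualAnnihilator h𝒜 hd hz)) K (hK.noethFL h𝒜 hd hz h) rfl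
      exact (hg.congr hd (hK.lam_eventuallyEq h𝒜 hd hz h.length_lt_top)).exists_of_diffOp

end CentralAction

/-! ### The main theorem. -/

theorem mainTheorem3
    {T : Type u} [Category.{v} T] [HasZeroObject T] [HasShift T ℤ] [Preadditive T]
    [∀ n : ℤ, (shiftFunctor T n).Additive] [Pretriangulated T] [IsTriangulated T]
    {R : Type w} [Ring R] [IsNoetherianRing R] (𝒜 : ℕ → AddSubgroup R) [GradedRing 𝒜]
    (hcomm : GradedCommutative 𝒜)
    (d : ℕ) (hd : Even d) (hd₂ : 2 ≤ d)
    (hgen : Subring.closure ((𝒜 0 : Set R) ∪ (𝒜 d : Set R)) = ⊤)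
    (hR₀ : ContainsInfiniteField (𝒜 0) ∨ IsLocalWithInfiniteResidueField (𝒜 0))
    (φ : CentralAction T 𝒜) (X Y : T) (hXY : φ.NoethFL X Y) :
    φ.HasComplexity d X Y (φ.cx d X Y) ∧
    ∃ z : 𝒜 d, φ.EventuallyInjective X Y z ∧
      ∀ K : T, φ.IsKoszulObject z Y K →
        φ.NoethFL X K ∧
        φ.HasComplexity d X K (φ.cx d X K) ∧
        (1 ≤ φ.cx d X Y → φ.cx d X K = φ.cx d X Y - 1) ∧
        (∀ s : ℕ, φ.cx d X Y ≤ s → 2 ≤ φ.cx d X Y →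
          φ.IsMultiplicity d X Y s (φ.multiplicity d X Y s) ∧
          φ.IsMultiplicity d X K (s - 1) (φ.multiplicity d X K (s - 1)) ∧
          φ.multiplicity d X K (s - 1) = φ.multiplicity d X Y s) ∧
        (φ.cx d X Y = 1 → φ.VanishesBelow X Y →
          φ.IsMultiplicity d X Y 1 (φ.multiplicity d X Y 1) ∧
          φ.IsMultiplicity d X K 0 (φ.multiplicity d X K 0) ∧
          φ.multiplicity d X K 0 = φ.multiplicity d X Y 1) := by
  -- The commutative structure extends the given ring structure, so the grading and the action are
  -- unchanged.
  let : CommRing R :=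
    { ‹Ring R› with mul_comm := hcomm.mul_comm_of_closure_eq_top hd hgen }
  have hd₁ : 1 ≤ d := by omega
  have h𝒜 : ∀ m, ¬ Even m → ∀ r : 𝒜 m, r = 0 := fun m hm =>
    eq_zero_of_closure_eq_top hd₁ hgen fun hdvd => hm (hd.trans_dvd hdvd)
  obtain ⟨g, hg⟩ := φ.exists_isEventuallyPolynomial h𝒜 hd₁ hgen hR₀ X Y hXY
  have hc : φ.HasComplexity d X Y (φ.cx d X Y) :=
    CentralAction.HasComplexity.hasComplexity_cx ⟨g, hg, rfl⟩
  obtain ⟨z, hz⟩ := φ.exists_eventuallyInjective X Y hd₁ hgen hR₀ hXY.noetherian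
  refine ⟨hc, z, hz, fun K hK => ?_⟩
  have hlen := hXY.length_lt_top
  have hcK := hK.hasComplexity h𝒜 hd₁ hz hlen hc
  refine ⟨hK.noethFL h𝒜 hd₁ hz hXY, hcK.hasComplexity_cx, fun _ => hcK.cx_eq,
    fun s hs h₂ => ?_, fun h₁ hY => ?_⟩
  · obtain ⟨e, he, he'⟩ := hc.exists_isMultiplicity hd₁ hd (by omega) hs
    have heK := hK.isMultiplicity_pred h𝒜 hd₁ hd hz hlen hc h₂ hs he'
    rw [he.multiplicity_eq, heK.multiplicity_eq]
    exact ⟨he, heK, rfl⟩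
  · obtain ⟨e, he, he'⟩ := hc.exists_isMultiplicity hd₁ hd h₁.ge h₁.le
    have heK := hK.isMultiplicity_zero h𝒜 hd₁ hd hz hlen hc h₁ hY he'
    rw [he.multiplicity_eq, heK.multiplicity_eq]
    exact ⟨he, heK, rfl⟩
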